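/- **Theorem (Asymptotic efficiency of A/B testing).** Let $\mathcal S$ be a finite state space, let the actions be $\mathfrak t$ (treatment) and $\mathfrak c$ (control), both available in every state, and let $0\le\gamma<1$. For parameters $\theta=(P,r)$, where $P(\cdot\mid s,a)$ is a probability distribution on $\mathcal S$ and $r(s,a)\in\mathbb R$ for each $(s,a)$, consider the Markov decision process in which action $a$ in state $s$ gives an independent reward with law $\mathcal N(r(s,a),\sigma^2(s,a))$, $\sigma^2(s,a)\in[0,\infty)$, and a next state with law $P(\cdot\mid s,a)$. The parameter space $\Theta$ consists of all such $\theta$: the treatment and control parameters are not assumed to agree in any state. The variances $\sigma^2$ are fixed. Let $\pi^{\mathfrak t}\equiv\mathfrak t$, $\pi^{\mathfrak c}\equiv\mathfrak c$ and $\pi^{1/2}=\tfrac12\pi^{\mathfrak t}+\tfrac12\pi^{\mathfrak c}$. For $a\in\{\mathfrak t,\mathfrak c\}$ let $P^a=(P(s'\mid s,a))_{s,s'}$, $\sigma_a^2(s)=\sigma^2(s,a)$, and let $V^a(s)=\mathbb E\big[\sum_{i\ge0}\gamma^i r(s_i,a_i)\mid \pi^a,s_0=s\big]$. The average treatment effect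 is $\Delta(\theta)=V^{\mathfrak t}-V^{\mathfrak c}\in\mathbb R^{\mathcal S}$. Fix a true parameter $\theta\in\Theta$ and let $\mu_{1/2}$ be a stationary distribution, with $\mu_{1/2}(s)>0$ for all $s$, of the state chain that $\pi^{1/2}$ induces under $\theta$. Run $\pi^{1/2}$ for $T\ge1$ steps from initial state distribution $\mu_{1/2}$ and observe $\tau=\{(s_i,a_i,s_{i+1},r_i)\}_{i=1}^T$. The initial distribution is known: it is the same $\mu_{1/2}$ for all parameters $\theta'\in\Theta$ in the definitions of unbiasedness below. Let $\hat\Delta(\tau)\in\mathbb R^{\mathcal S}$ be an estimator with finite second moments under $\theta$, and let $\Sigma$ be its covariance matrix under $\theta$. Assume that * $\hat\Delta$ is unbiased, i.e. $\hat\Delta$ is integrable under $\theta'$ and $\mathbb E_{\theta'}\hat\Delta=\Delta(\theta')$ for all $\theta'\in\Theta$; or, more generally, that * $\hat\Delta$ is locally unbiased at $\theta$, i.e. $\mathbb E_{\theta}\hat\Delta=\Delta(\theta)$ and $\mathbb E_{\theta'}\hat\Delta-\Delta(\theta')=o(\|\theta'-\theta\|)$ as $\theta'\to\theta$ in $\Theta$.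 Then, in the positive semidefinite order, $$\Sigma_{\mathrm{AB}}\preceq T\,\Sigma ,$$ where $$\Sigma_{\mathrm{AB}}=2\sum_{a\in\{\mathfrak t,\mathfrak c\}}(I-\gamma P^a)^{-1}\,\mathrm{Diag}_{s\in\mathcal S}\!\left(\frac{\sigma_a^2(s)}{\mu_{1/2}(s)}+\frac{\|\gamma V^a\|^2_{\Sigma_{p^a}(s)}}{\mu_{1/2}(s)}\right)(I-\gamma P^a)^{-\top},$$ $\|x\|_A^2=x^\top A x$, $\Sigma_{p^a}(s)=\mathrm{Diag}(p_s)-p_sp_s^\top$, and $p_s=(P(s'\mid s,a))_{s'\in\mathcal S}$. -/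

import Mathlib

open MeasureTheory ProbabilityTheory Asymptotics Topology
open scoped NNReal ENNReal Matrix

namespace ABTesting

noncomputable section

/-- The two actions, available in every state: `true` is the treatment action,
`false` is the control action. -/
abbrev Action : Type := Bool

/-- The unknown parameters of the decision process: `θ.1 s a s'` is the probability `P(s' ∣ s, a)`
and `θ.2 s a` is the mean reward `r(s, a)`.  No relation is imposed between the treatment and the
control parameters. -/
abbrev Param (S : Type*) : Type _ := (S → Action → S → ℝ) × (S → Action → ℝ)

/-- A randomized stationary policy, `π s a = π(a ∣ s)`. -/
abbrev Policy (S : Type*) : Type _ := S → Action → ℝ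

/-- The trajectory `((s_i, a_i, s_{i+1}, r_i))` for `i = 1, …, T`. -/
abbrev Trajectory (S : Type*) (T : ℕ) : Type _ := Fin T → S × Action × S × ℝ

section Model

variable {S : Type*}

/-- The treatment policy: always play the treatment action. -/
def treatmentPolicy : Policy S := fun _ a => if a = true then 1 else 0

/-- The control policy: always play the control action. -/
def controlPolicy : Policy S := fun _ a => if a = false then 1 else 0

/-- The experimental policy `π^{1/2}`: a fair coin chooses between treatment and control. -/
def mixedPolicy : Policy S := fun s a =>
  (1 / 2) * treatmentPolicy s a + (1 / 2) * controlPolicy s a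

variable [Fintype S]

/-- The parameter space: every `P(· ∣ s, a)` is a probability vector, mean rewards are arbitrary. -/
def paramSpace (S : Type*) [Fintype S] : Set (Param S) :=
  {θ | (∀ s a s', 0 ≤ θ.1 s a s') ∧ ∀ s a, ∑ s', θ.1 s a s' = 1}

/-- The transition matrix `P^π(s, s') = ∑ₐ P(s' ∣ s, a) π(a ∣ s)`. -/
def transitionMatrix (θ : Param S) (π : Policy S) : Matrix S S ℝ :=
  Matrix.of fun s s' => ∑ a, θ.1 s a s' * π s a

/-- The reward variance `σ_π²(s) = ∑ₐ π(a ∣ s) σ²(s, a)`; here `v s a = σ²(s, a)`. -/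
def policyVariance (v : S → Action → ℝ≥0) (π : Policy S) (s : S) : ℝ :=
  ∑ a, π s a * (v s a : ℝ)

/-- `μ` is a stationary distribution of the transition matrix `Q`. -/
structure IsStationary (μ : S → ℝ) (Q : Matrix S S ℝ) : Prop where
  nonneg : ∀ s, 0 ≤ μ s
  sum_eq_one : ∑ s, μ s = 1
  stationary : μ ᵥ* Q = μ

/-- The probability of the state path `s` and action path `a` under the policy `π`, with initial
state distribution `μ`. -/
def pathProb (θ : Param S) (π : Policy S) (μ : S → ℝ) {T : ℕ}
    (s : Fin (T + 1) → S) (a : Fin T → Action) : ℝ :=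
  μ (s 0) * ∏ i : Fin T, π (s i.castSucc) (a i) * θ.1 (s i.castSucc) (a i) (s i.succ)

variable [MeasurableSpace S]

/-- The law of the length-`T` trajectory under the policy `π` with initial state distribution `μ`:
the states and actions follow `pathProb`, and given those the rewards are independent with
`r_i ∼ N(r(s_i, a_i), σ²(s_i, a_i))`. -/
def trajectoryLaw (v : S → Action → ℝ≥0) (θ : Param S) (π : Policy S) (μ : S → ℝ) (T : ℕ) :
    Measure (Trajectory S T) :=
  ∑ s : Fin (T + 1) → S, ∑ a : Fin T → Action,
    ENNReal.ofReal (pathProb θ π μ s a) •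
      (Measure.pi fun i : Fin T => gaussianReal (θ.2 (s i.castSucc) (a i))
        (v (s i.castSucc) (a i))).map fun r i => (s i.castSucc, a i, s i.succ, r i)

variable [DecidableEq S]

/-- The value function `V^π(s) = E[∑ᵢ γ^i r(s_i, a_i) ∣ π, s_0 = s]`, `i ≥ 0`.  As the mean rewards
are bounded and `0 ≤ γ < 1`, the expectation is taken term by term; the pair `(s_i, a_i)` is read
from the last transition of the trajectory of length `i + 1` started at `s`. -/
def value (γ : ℝ) (v : S → Action → ℝ≥0) (θ : Param S) (π : Policy S) (s : S) : ℝ :=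
  ∑' i : ℕ, γ ^ i * ∫ τ, θ.2 (τ (Fin.last i)).1 (τ (Fin.last i)).2.1
    ∂(trajectoryLaw v θ π (Pi.single s 1) (i + 1))

/-- The average treatment effect `Δ = V^t - V^c`, a vector indexed by the initial state. -/
def ate (γ : ℝ) (v : S → Action → ℝ≥0) (θ : Param S) (s : S) : ℝ :=
  value γ v θ treatmentPolicy s - value γ v θ controlPolicy s

/-- The covariance matrix `Diag(p_s) - p_s p_sᵀ` of the next-state indicator vector from `s`. -/
def transitionCov (θ : Param S) (π : Policy S) (s : S) : Matrix S S ℝ :=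
  Matrix.diagonal (transitionMatrix θ π s) -
    Matrix.vecMulVec (transitionMatrix θ π s) (transitionMatrix θ π s)

/-- `(I - γ P^π)⁻¹ Diag_s ((σ_π²(s) + ‖γ V^π‖²_{Σ_{p^π(s)}}) / μ(s)) (I - γ P^π)⁻ᵀ`,
where `‖x‖²_A = xᵀ A x`. -/
def armCov (γ : ℝ) (v : S → Action → ℝ≥0) (θ : Param S) (μ : S → ℝ) (π : Policy S) :
    Matrix S S ℝ :=
  (1 - γ • transitionMatrix θ π)⁻¹ *
    Matrix.diagonal (fun s =>
      policyVariance v π s / μ s +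
        ((γ • value γ v θ π) ⬝ᵥ (transitionCov θ π s *ᵥ (γ • value γ v θ π))) / μ s) *
    ((1 - γ • transitionMatrix θ π)⁻¹)ᵀ

/-- The matrix `Σ_AB`. -/
def sigmaAB (γ : ℝ) (v : S → Action → ℝ≥0) (θ : Param S) (μ : S → ℝ) : Matrix S S ℝ :=
  2 • armCov γ v θ μ treatmentPolicy + 2 • armCov γ v θ μ controlPolicy

/-- The law of the experimental data: `π^{1/2}` is run for `T` steps from the initial state
distribution `μ`. -/
def experimentLaw (v : S → Action → ℝ≥0) (μ : S → ℝ) (T : ℕ) (θ : Param S) :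
    Measure (Trajectory S T) :=
  trajectoryLaw v θ mixedPolicy μ T

/-- The estimator is unbiased for the average treatment effect: its mean is the effect, whatever
the parameters of the process are.  The initial distribution `μ` of the experiment and the reward
variances `v` are fixed and known. -/
def IsUnbiased (γ : ℝ) (v : S → Action → ℝ≥0) (μ : S → ℝ) {T : ℕ}
    (est : Trajectory S T → S → ℝ) : Prop :=
  ∀ θ ∈ paramSpace S, ∀ s, Integrable (fun τ => est τ s) (experimentLaw v μ T θ) ∧
    ∫ τ, est τ s ∂(experimentLaw v μ T θ) = ate γ v θ s

/-- The estimator is locally unbiased at `θ₀`: its bias vanishes at `θ₀`, and vanishes to first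
order when the parameters tend to `θ₀` in the parameter space. -/
def IsLocallyUnbiasedAt (γ : ℝ) (v : S → Action → ℝ≥0) (μ : S → ℝ) {T : ℕ}
    (est : Trajectory S T → S → ℝ) (θ₀ : Param S) : Prop :=
  ∀ s, ∫ τ, est τ s ∂(experimentLaw v μ T θ₀) = ate γ v θ₀ s ∧
    (fun θ => ∫ τ, est τ s ∂(experimentLaw v μ T θ) - ate γ v θ s)
      =o[𝓝[paramSpace S] θ₀] fun θ => θ - θ₀

/-- The covariance matrix of the estimator under the parameters `θ`. -/
def estimatorCov (v : S → Action → ℝ≥0) (μ : S → ℝ) {T : ℕ}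
    (est : Trajectory S T → S → ℝ) (θ : Param S) : Matrix S S ℝ :=
  Matrix.of fun s s' =>
    cov[fun τ => est τ s, fun τ => est τ s'; experimentLaw v μ T θ]

end Model

end

end ABTesting

/-!
The estimator is compared with the estimand along one least favourable one-parameter submodel for
each vector `x`, as in the Cramér–Rao inequality.

For `φ` with `∑ s', P(s' ∣ s, a) φ s a s' = 0` and for `k`, `tiltedParam` moves `P` to
`P (1 + t φ)` and the mean reward `r` to `r + t k σ²`.  Both moves keep the law of the trajectory
absolutely continuous, also where transition probabilities or reward variances vanish, and the
likelihood ratio `L_t` is an explicit product over the transitions (`trajectoryLaw_tiltedParam`).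
The Chapman–Robbins inequality `sq_integral_withDensity_sub_le` bounds
`(E_t Z - E_0 Z)²` by `Var Z * (E L_t² - 1)`, so no derivative has to be taken under an integral.
After division by `t²`, the left side tends to the squared derivative of the estimand, as the bias
of a locally unbiased estimator is `o(t)`.  On the right, `E L_t²` is `μ ⬝ (M_t ^ T) 1` for a
matrix `M_t` such that `M_0` is the transition matrix, `M_t 1 = 1 + t² b + o(t²)`, and
stationarity of `μ` gives the limit `T (μ ⬝ b)`, the Fisher information of the `T` transitions
(`tendsto_chiSq_div_sq`).

The value functions are treated through their Bellman equations `V = r + γ P V`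
(`value_bellman`).  The perturbation identity `(I - γ P)(V_t - V) = (r_t - r) + γ (P_t - P) V_t`
yields the derivative of `x ⬝ V^a` (`tendsto_slope_dotProduct_value`), in which the weight
`y_a = (I - γ P^a)⁻ᵀ x` appears.

The direction is chosen so that the score of a transition is `± y_a(s) / μ(s)` times the centred
Bellman target `r + γ V^a(s')`.  With `D = xᵀ Σ_AB x / 2`, the derivative of the estimand in this
direction is `D` and the information is `T D / 2`; hence `D² ≤ Var(x ⬝ Δ̂) * T D / 2`, that is,
`xᵀ Σ_AB x = 2 D ≤ T * Var(x ⬝ Δ̂)` (`dotProduct_sigmaAB_mulVec_le`).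
-/

namespace ABTesting

/-! ### Gaussian shifts, product densities and the Cauchy–Schwarz inequality -/

/-- The density of `N(m + k v, v)` with respect to `N(m, v)`.  For `v = 0` both measures are the
same Dirac mass at `m`, and the density equals `1` at `m`. -/
noncomputable def gaussianShift (m : ℝ) (v : ℝ≥0) (k x : ℝ) : ℝ :=
  Real.exp (k * (x - m) - k ^ 2 * v / 2)

lemma gaussianShift_nonneg (m : ℝ) (v : ℝ≥0) (k x : ℝ) : 0 ≤ gaussianShift m v k x :=
  (Real.exp_pos _).le

lemma measurable_gaussianShift (m : ℝ) (v : ℝ≥0) (k : ℝ) : Measurable (gaussianShift m v k) := by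
  unfold gaussianShift
  fun_prop

lemma gaussianReal_shift_eq_withDensity (m : ℝ) (v : ℝ≥0) (k : ℝ) :
    gaussianReal (m + k * v) v =
      (gaussianReal m v).withDensity fun x => ENNReal.ofReal (gaussianShift m v k x) := by
  have hmeas : Measurable fun x => ENNReal.ofReal (gaussianShift m v k x) :=
    (measurable_gaussianShift m v k).ennreal_ofReal
  by_cases hv : v = 0
  · subst hv
    ext s hs
    rw [withDensity_apply _ hs]
    simp [gaussianReal_zero_var, ← lintegral_indicator hs, Set.indicator, gaussianShift]
  · rw [gaussianReal_of_var_ne_zero _ hv, gaussianReal_of_var_ne_zero _ hv,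
      ← withDensity_mul _ (measurable_gaussianPDF m v) hmeas]
    congr 1
    funext x
    have hv' : (v : ℝ) ≠ 0 := by exact_mod_cast hv
    simp only [Pi.mul_apply, gaussianPDF, gaussianShift]
    rw [← ENNReal.ofReal_mul (gaussianPDFReal_nonneg _ _ _)]
    simp only [gaussianPDFReal]
    rw [mul_assoc _ (Real.exp _) (Real.exp _), ← Real.exp_add]
    congr 3
    field_simp
    ring

lemma gaussianShift_sq (m : ℝ) (v : ℝ≥0) (k x : ℝ) :
    gaussianShift m v k x ^ 2 =
      Real.exp (-(2 * k) * m - k ^ 2 * v) * Real.exp (2 * k * x) := by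
  rw [gaussianShift, ← Real.exp_nat_mul, ← Real.exp_add]
  congr 1
  push_cast
  ring

lemma integrable_gaussianShift_sq (m : ℝ) (v : ℝ≥0) (k : ℝ) :
    Integrable (fun x => gaussianShift m v k x ^ 2) (gaussianReal m v) := by
  simp_rw [gaussianShift_sq]
  exact (integrable_exp_mul_gaussianReal (2 * k)).const_mul _

lemma integral_gaussianShift_sq (m : ℝ) (v : ℝ≥0) (k : ℝ) :
    ∫ x, gaussianShift m v k x ^ 2 ∂(gaussianReal m v) = Real.exp (k ^ 2 * v) := by
  have h := congrFun (mgf_id_gaussianReal (μ := m) (v := v)) (2 * k)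
  simp only [mgf, id] at h
  simp_rw [gaussianShift_sq]
  rw [integral_const_mul, h, ← Real.exp_add]
  congr 1
  ring

lemma lintegral_pi_prod_eq_prod {ι : Type*} [Fintype ι] {E : ι → Type*}
    [∀ i, MeasurableSpace (E i)] (μ : ∀ i, Measure (E i)) [∀ i, IsProbabilityMeasure (μ i)]
    (f : ∀ i, E i → ℝ≥0∞) (hf : ∀ i, Measurable (f i)) :
    ∫⁻ x, ∏ i, f i (x i) ∂(Measure.pi μ) = ∏ i, ∫⁻ x, f i x ∂(μ i) := by
  have hind := iIndepFun_pi (μ := μ) (X := f) fun i => (hf i).aemeasurable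
  rw [lintegral_prod_eq_prod_lintegral_of_indepFun Finset.univ _ hind
    fun i => (hf i).comp (measurable_pi_apply i)]
  exact Finset.prod_congr rfl fun i _ => (measurePreserving_eval μ i).lintegral_comp (hf i)

lemma pi_withDensity_eq {ι : Type*} [Fintype ι] {E : ι → Type*}
    [∀ i, MeasurableSpace (E i)] (μ ν : ∀ i, Measure (E i)) [∀ i, IsProbabilityMeasure (μ i)]
    [∀ i, SigmaFinite (ν i)] (f : ∀ i, E i → ℝ≥0∞) (hf : ∀ i, Measurable (f i))
    (h : ∀ i, ν i = (μ i).withDensity (f i)) :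
    Measure.pi ν = (Measure.pi μ).withDensity fun x => ∏ i, f i (x i) := by
  refine (Measure.pi_eq fun s hs => ?_)
  rw [withDensity_apply _ (MeasurableSet.univ_pi hs),
    ← lintegral_indicator (MeasurableSet.univ_pi hs)]
  have hind : ∀ x, (Set.univ.pi s).indicator (fun x => ∏ i, f i (x i)) x =
      ∏ i, (s i).indicator (f i) (x i) := by
    intro x
    by_cases hx : ∀ i, x i ∈ s i
    · rw [Set.indicator_of_mem (by simpa using hx)]
      exact Finset.prod_congr rfl fun i _ => (Set.indicator_of_mem (hx i) _).symm
    · rw [Set.indicator_of_notMem (by simpa using hx)]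
      push Not at hx
      obtain ⟨i, hi⟩ := hx
      exact (Finset.prod_eq_zero (Finset.mem_univ i) (Set.indicator_of_notMem hi _)).symm
  simp_rw [hind]
  rw [lintegral_pi_prod_eq_prod μ _ fun i => (hf i).indicator (hs i)]
  refine Finset.prod_congr rfl fun i _ => ?_
  rw [lintegral_indicator (hs i), h i, withDensity_apply _ (hs i)]

lemma map_withDensity_comp {α β : Type*} [MeasurableSpace α] [MeasurableSpace β]
    (μ : Measure α) {g : α → β} (hg : Measurable g) {f : β → ℝ≥0∞} (hf : Measurable f) :
    (μ.withDensity (f ∘ g)).map g = (μ.map g).withDensity f := by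
  ext s hs
  rw [Measure.map_apply hg hs, withDensity_apply _ (hg hs), withDensity_apply _ hs,
    setLIntegral_map hs hf hg]
  rfl

lemma withDensity_finset_sum_measure {α ι : Type*} [MeasurableSpace α] (s : Finset ι)
    (μ : ι → Measure α) (f : α → ℝ≥0∞) :
    (∑ i ∈ s, μ i).withDensity f = ∑ i ∈ s, (μ i).withDensity f := by
  classical
  induction s using Finset.induction_on with
  | empty => simp
  | insert i s hi ih => rw [Finset.sum_insert hi, Finset.sum_insert hi, withDensity_add_measure, ih]

lemma integral_mul_sq_le {α : Type*} [MeasurableSpace α] {μ : Measure α} {X Y : α → ℝ}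
    (hX : MemLp X 2 μ) (hY : MemLp Y 2 μ) :
    (∫ a, X a * Y a ∂μ) ^ 2 ≤ (∫ a, X a ^ 2 ∂μ) * ∫ a, Y a ^ 2 ∂μ := by
  have hXY : Integrable (fun a => X a * Y a) μ := hX.integrable_mul hY
  have key : ∀ t : ℝ, 0 ≤ (∫ a, X a ^ 2 ∂μ) * (t * t) + (2 * ∫ a, X a * Y a ∂μ) * t
      + ∫ a, Y a ^ 2 ∂μ := by
    intro t
    have h : ∫ a, (t * X a + Y a) ^ 2 ∂μ = (∫ a, X a ^ 2 ∂μ) * (t * t)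
        + (2 * ∫ a, X a * Y a ∂μ) * t + ∫ a, Y a ^ 2 ∂μ := by
      have : ∀ a, (t * X a + Y a) ^ 2 = t * t * X a ^ 2 + 2 * t * (X a * Y a) + Y a ^ 2 :=
        fun a => by ring
      simp_rw [this]
      have hX2 : Integrable (fun a => t * t * X a ^ 2) μ := hX.integrable_sq.const_mul _
      have hXY2 : Integrable (fun a => 2 * t * (X a * Y a)) μ := hXY.const_mul _
      have hadd : Integrable (fun a => t * t * X a ^ 2 + 2 * t * (X a * Y a)) μ := hX2.add hXY2
      rw [integral_add hadd hY.integrable_sq, integral_add hX2 hXY2, integral_const_mul,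
        integral_const_mul]
      ring
    rw [← h]
    exact integral_nonneg fun a => sq_nonneg _
  -- The quadratic polynomial `t ↦ ∫ (t X + Y)²` is nonnegative, so its discriminant is not positive.
  have := discrim_le_zero key
  rw [discrim] at this
  nlinarith

/-- The Chapman–Robbins inequality: the squared change of the mean of `Z` under the change of
measure with density `f` is at most the variance of `Z` times the `χ²`-divergence. -/
lemma sq_integral_withDensity_sub_le {α : Type*} [MeasurableSpace α] {μ : Measure α}
    [IsProbabilityMeasure μ] {Z f : α → ℝ} (hZ : MemLp Z 2 μ) (hf : MemLp f 2 μ)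
    (hfm : Measurable f) (hf0 : 0 ≤ f)
    [IsProbabilityMeasure (μ.withDensity fun a => ENNReal.ofReal (f a))] :
    (∫ a, Z a ∂(μ.withDensity fun a => ENNReal.ofReal (f a)) - ∫ a, Z a ∂μ) ^ 2 ≤
      Var[Z; μ] * (∫ a, f a ^ 2 ∂μ - 1) := by
  have hZi : Integrable Z μ := hZ.integrable one_le_two
  have hfi : Integrable f μ := hf.integrable one_le_two
  have hfZ : Integrable (fun a => f a * Z a) μ := hf.integrable_mul hZ
  have hf1 : ∫ a, f a ∂μ = 1 := by
    have h := measure_univ (μ := μ.withDensity fun a => ENNReal.ofReal (f a))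
    rw [withDensity_apply _ MeasurableSet.univ, Measure.restrict_univ,
      ← ofReal_integral_eq_lintegral_ofReal hfi (Filter.Eventually.of_forall hf0)] at h
    exact ENNReal.ofReal_eq_one.mp h
  have h1 : ∫ a, Z a ∂(μ.withDensity fun a => ENNReal.ofReal (f a)) = ∫ a, f a * Z a ∂μ := by
    rw [integral_withDensity_eq_integral_toReal_smul hfm.ennreal_ofReal
      (Filter.Eventually.of_forall fun _ => ENNReal.ofReal_lt_top)]
    simp [ENNReal.toReal_ofReal (hf0 _)]
  set z := ∫ a, Z a ∂μ
  have h2 : ∫ a, (Z a - z) * (f a - 1) ∂μ = ∫ a, f a * Z a ∂μ - z := by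
    have : ∀ a, (Z a - z) * (f a - 1) = f a * Z a - Z a - (z * f a - z) := fun a => by ring
    simp_rw [this]
    have hl : Integrable (fun a => f a * Z a - Z a) μ := hfZ.sub hZi
    have hr : Integrable (fun a => z * f a - z) μ := (hfi.const_mul _).sub (integrable_const _)
    rw [integral_sub hl hr,
      integral_sub hfZ hZi, integral_sub (hfi.const_mul _) (integrable_const _),
      integral_const_mul, hf1]
    simp [z]
  have h3 : ∫ a, (f a - 1) ^ 2 ∂μ = ∫ a, f a ^ 2 ∂μ - 1 := by
    have : ∀ a, (f a - 1) ^ 2 = f a ^ 2 - (2 * f a - 1) := fun a => by ring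
    simp_rw [this]
    have hr : Integrable (fun a => 2 * f a - 1) μ := (hfi.const_mul _).sub (integrable_const _)
    rw [integral_sub hf.integrable_sq hr,
      integral_sub (hfi.const_mul _) (integrable_const _), integral_const_mul, hf1]
    norm_num
  rw [h1, ← h2, variance_eq_integral hZ.aemeasurable, ← h3]
  exact integral_mul_sq_le (hZ.sub (memLp_const z)) (hf.sub (memLp_const 1))

/-! ### Sums over state-action paths -/

lemma sum_fin_succ_eq_sum_snoc {α M : Type*} [Fintype α] [AddCommMonoid M] {n : ℕ}
    (f : (Fin (n + 1) → α) → M) :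
    ∑ s, f s = ∑ s : Fin n → α, ∑ x, f (Fin.snoc s x) := by
  rw [← (Fin.snocEquiv fun _ : Fin (n + 1) => α).sum_comp f, Fintype.sum_prod_type,
    Finset.sum_comm]
  rfl

section PathSums

variable {S A : Type*} [Fintype S] [Fintype A]

/-- The last transition of a path can be summed out first. -/
lemma sum_paths_succ (μ : S → ℝ) (K F : S → A → S → ℝ) (n : ℕ) :
    ∑ s : Fin (n + 2) → S, ∑ a : Fin (n + 1) → A,
        μ (s 0) * (∏ i : Fin (n + 1), K (s i.castSucc) (a i) (s i.succ)) *
          F (s (Fin.last n).castSucc) (a (Fin.last n)) (s (Fin.last (n + 1))) =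
      ∑ s : Fin (n + 1) → S, ∑ a : Fin n → A,
        μ (s 0) * (∏ i : Fin n, K (s i.castSucc) (a i) (s i.succ)) *
          ∑ b, ∑ x, K (s (Fin.last n)) b x * F (s (Fin.last n)) b x := by
  rw [sum_fin_succ_eq_sum_snoc]
  refine Finset.sum_congr rfl fun s _ => ?_
  simp_rw [sum_fin_succ_eq_sum_snoc (fun a : Fin (n + 1) → A => _)]
  rw [Finset.sum_comm]
  refine Finset.sum_congr rfl fun a _ => ?_
  rw [Finset.sum_comm, Finset.mul_sum]
  refine Finset.sum_congr rfl fun b _ => ?_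
  rw [Finset.mul_sum]
  refine Finset.sum_congr rfl fun x _ => ?_
  have h0 : (Fin.snoc s x : Fin (n + 2) → S) 0 = s 0 :=
    Fin.snoc_castSucc (α := fun _ => S) x s 0
  rw [Fin.prod_univ_castSucc, h0]
  simp only [Fin.snoc_castSucc, Fin.snoc_last, Fin.succ_castSucc, Fin.succ_last]
  ring

variable [DecidableEq S]

lemma sum_paths_eq_vecMul_pow (μ : S → ℝ) (K : S → A → S → ℝ) (f : S → ℝ) (n : ℕ) :
    ∑ s : Fin (n + 1) → S, ∑ a : Fin n → A,
        μ (s 0) * (∏ i : Fin n, K (s i.castSucc) (a i) (s i.succ)) * f (s (Fin.last n)) =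
      μ ⬝ᵥ ((Matrix.of fun s s' => ∑ a, K s a s') ^ n *ᵥ f) := by
  induction n generalizing f with
  | zero =>
    rw [sum_fin_succ_eq_sum_snoc]
    simp [dotProduct, Fin.snoc]
  | succ n ih =>
    have h := sum_paths_succ μ K (fun _ _ x => f x) n
    rw [h]
    have := ih ((Matrix.of fun s s' => ∑ a, K s a s') *ᵥ f)
    rw [pow_succ, ← Matrix.mulVec_mulVec, ← this]
    refine Finset.sum_congr rfl fun s _ => Finset.sum_congr rfl fun a _ => ?_
    congr 1
    simp only [Matrix.mulVec, dotProduct, Matrix.of_apply, Finset.sum_mul]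
    rw [Finset.sum_comm]

end PathSums

/-! ### Integration against the trajectory law -/

section Law

variable {S : Type*} [Fintype S]

/-- `π(· ∣ s)` is a probability vector for each `s`. -/
structure IsPolicy (π : Policy S) : Prop where
  nonneg : ∀ s a, 0 ≤ π s a
  sum_eq_one : ∀ s, ∑ a, π s a = 1

/-- The policy that always plays the action `a`. -/
def armPolicy (a : Action) : Policy S := fun _ b => if b = a then 1 else 0

omit [Fintype S] in
lemma armPolicy_isPolicy (a : Action) : IsPolicy (armPolicy a : Policy S) where
  nonneg s b := by unfold armPolicy; split_ifs <;> norm_num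
  sum_eq_one s := by simp [armPolicy]

omit [Fintype S] in
lemma mixedPolicy_apply (s : S) (a : Action) : mixedPolicy s a = 1 / 2 := by
  cases a <;> simp [mixedPolicy, treatmentPolicy, controlPolicy]

omit [Fintype S] in
lemma mixedPolicy_isPolicy : IsPolicy (mixedPolicy : Policy S) where
  nonneg s a := by rw [mixedPolicy_apply]; norm_num
  sum_eq_one s := by simp [mixedPolicy_apply]

lemma pathProb_nonneg {θ : Param S} (hθ : θ ∈ paramSpace S) {π : Policy S} (hπ : IsPolicy π)
    {μ : S → ℝ} (hμ : ∀ s, 0 ≤ μ s) {T : ℕ} (s : Fin (T + 1) → S) (a : Fin T → Action) :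
    0 ≤ pathProb θ π μ s a :=
  mul_nonneg (hμ _) (Finset.prod_nonneg fun _ _ => mul_nonneg (hπ.nonneg _ _) (hθ.1 _ _ _))

lemma transitionMatrix_mulVec_one {θ : Param S} (hθ : θ ∈ paramSpace S) {π : Policy S}
    (hπ : IsPolicy π) : transitionMatrix θ π *ᵥ 1 = 1 := by
  funext s
  simp only [transitionMatrix, Matrix.mulVec, dotProduct, Matrix.of_apply, Pi.one_apply, mul_one]
  rw [Finset.sum_comm]
  simp_rw [← Finset.sum_mul, hθ.2, one_mul]
  exact hπ.sum_eq_one s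

variable [DecidableEq S]

lemma sum_pathProb_mul_eq (θ : Param S) (π : Policy S) (μ : S → ℝ) (g : S → Action → S → ℝ)
    (T : ℕ) :
    ∑ s : Fin (T + 1) → S, ∑ a : Fin T → Action,
        pathProb θ π μ s a * ∏ i : Fin T, g (s i.castSucc) (a i) (s i.succ) =
      μ ⬝ᵥ ((Matrix.of fun s s' => ∑ a, π s a * θ.1 s a s' * g s a s') ^ T *ᵥ 1) := by
  rw [← sum_paths_eq_vecMul_pow μ (fun s a s' => π s a * θ.1 s a s' * g s a s')]
  simp only [pathProb, Finset.prod_mul_distrib, Pi.one_apply]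
  refine Finset.sum_congr rfl fun s _ => Finset.sum_congr rfl fun a _ => ?_
  ring

lemma sum_pathProb {θ : Param S} (hθ : θ ∈ paramSpace S) {π : Policy S} (hπ : IsPolicy π)
    (μ : S → ℝ) (T : ℕ) :
    ∑ s : Fin (T + 1) → S, ∑ a : Fin T → Action, pathProb θ π μ s a = ∑ s, μ s := by
  have h := sum_pathProb_mul_eq θ π μ (fun _ _ _ => 1) T
  simp only [Finset.prod_const_one, mul_one] at h
  have hM : (Matrix.of fun s s' => ∑ a, π s a * θ.1 s a s') = transitionMatrix θ π := by
    ext s s'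
    simp [transitionMatrix, mul_comm]
  have hpow : ∀ n : ℕ, transitionMatrix θ π ^ n *ᵥ 1 = 1 := by
    intro n
    induction n with
    | zero => simp
    | succ n ih =>
      rw [pow_succ, ← Matrix.mulVec_mulVec, transitionMatrix_mulVec_one hθ hπ, ih]
  rw [h, hM, hpow]
  simp [dotProduct]

variable [MeasurableSpace S]

omit [Fintype S] [DecidableEq S] in
lemma measurable_trajectory_of_rewards {T : ℕ} (s : Fin (T + 1) → S) (a : Fin T → Action) :
    Measurable fun (r : Fin T → ℝ) (i : Fin T) => (s i.castSucc, a i, s i.succ, r i) := by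
  fun_prop

omit [DecidableEq S] in
lemma integrable_trajectoryLaw {v : S → Action → ℝ≥0} {θ : Param S} {π : Policy S} {μ : S → ℝ}
    {T : ℕ} {f : Trajectory S T → ℝ} (hf : Measurable f)
    (hint : ∀ (s : Fin (T + 1) → S) (a : Fin T → Action),
      Integrable (fun r : Fin T → ℝ => f fun i => (s i.castSucc, a i, s i.succ, r i))
        (Measure.pi fun i => gaussianReal (θ.2 (s i.castSucc) (a i)) (v (s i.castSucc) (a i)))) :
    Integrable f (trajectoryLaw v θ π μ T) := by
  unfold trajectoryLaw
  refine integrable_finsetSum_measure.2 fun s _ => integrable_finsetSum_measure.2 fun a _ => ?_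
  refine Integrable.smul_measure ?_ ENNReal.ofReal_ne_top
  exact (integrable_map_measure hf.aestronglyMeasurable
    (measurable_trajectory_of_rewards s a).aemeasurable).2 (hint s a)

omit [DecidableEq S] in
lemma integral_trajectoryLaw {v : S → Action → ℝ≥0} {θ : Param S} (hθ : θ ∈ paramSpace S)
    {π : Policy S} (hπ : IsPolicy π) {μ : S → ℝ} (hμ : ∀ s, 0 ≤ μ s)
    {T : ℕ} {f : Trajectory S T → ℝ} (hf : Measurable f)
    (hint : ∀ (s : Fin (T + 1) → S) (a : Fin T → Action),
      Integrable (fun r : Fin T → ℝ => f fun i => (s i.castSucc, a i, s i.succ, r i))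
        (Measure.pi fun i => gaussianReal (θ.2 (s i.castSucc) (a i)) (v (s i.castSucc) (a i)))) :
    ∫ τ, f τ ∂(trajectoryLaw v θ π μ T) =
      ∑ s : Fin (T + 1) → S, ∑ a : Fin T → Action, pathProb θ π μ s a *
        ∫ r : Fin T → ℝ, f (fun i => (s i.castSucc, a i, s i.succ, r i))
          ∂(Measure.pi fun i =>
            gaussianReal (θ.2 (s i.castSucc) (a i)) (v (s i.castSucc) (a i))) := by
  have hmap : ∀ (s : Fin (T + 1) → S) (a : Fin T → Action), Integrable f
      (ENNReal.ofReal (pathProb θ π μ s a) • (Measure.pi fun i => gaussianReal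
        (θ.2 (s i.castSucc) (a i)) (v (s i.castSucc) (a i))).map
          fun r i => (s i.castSucc, a i, s i.succ, r i)) := fun s a =>
    Integrable.smul_measure ((integrable_map_measure hf.aestronglyMeasurable
      (measurable_trajectory_of_rewards s a).aemeasurable).2 (hint s a)) ENNReal.ofReal_ne_top
  unfold trajectoryLaw
  rw [integral_finsetSum_measure fun s _ => integrable_finsetSum_measure.2 fun a _ => hmap s a]
  refine Finset.sum_congr rfl fun s _ => ?_
  rw [integral_finsetSum_measure fun a _ => hmap s a]
  refine Finset.sum_congr rfl fun a _ => ?_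
  rw [integral_smul_measure, integral_map (measurable_trajectory_of_rewards s a).aemeasurable
    hf.aestronglyMeasurable, ENNReal.toReal_ofReal (pathProb_nonneg hθ hπ hμ s a), smul_eq_mul]

lemma isProbabilityMeasure_trajectoryLaw (v : S → Action → ℝ≥0) {θ : Param S}
    (hθ : θ ∈ paramSpace S) {π : Policy S} (hπ : IsPolicy π) {μ : S → ℝ} (hμ : ∀ s, 0 ≤ μ s)
    (hμ1 : ∑ s, μ s = 1) (T : ℕ) : IsProbabilityMeasure (trajectoryLaw v θ π μ T) := by
  constructor
  unfold trajectoryLaw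
  simp only [Measure.finsetSum_apply, Measure.smul_apply, smul_eq_mul]
  have h1 : ∀ (s : Fin (T + 1) → S) (a : Fin T → Action),
      ((Measure.pi fun i => gaussianReal (θ.2 (s i.castSucc) (a i)) (v (s i.castSucc) (a i))).map
        fun r i => (s i.castSucc, a i, s i.succ, r i)) Set.univ = 1 := fun s a => by
    rw [Measure.map_apply (measurable_trajectory_of_rewards s a) MeasurableSet.univ]
    simp
  simp only [h1, mul_one]
  have h2 : ∀ s : Fin (T + 1) → S, ∑ a : Fin T → Action, ENNReal.ofReal (pathProb θ π μ s a) =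
      ENNReal.ofReal (∑ a : Fin T → Action, pathProb θ π μ s a) := fun s =>
    (ENNReal.ofReal_sum_of_nonneg fun a _ => pathProb_nonneg hθ hπ hμ s a).symm
  simp only [h2]
  rw [← ENNReal.ofReal_sum_of_nonneg fun s _ =>
    Finset.sum_nonneg fun a _ => pathProb_nonneg hθ hπ hμ s a, sum_pathProb hθ hπ, hμ1,
    ENNReal.ofReal_one]

end Law

/-! ### The tilted submodel and its likelihood ratio -/

section Tilt

variable {S : Type*}

/-- The one-parameter submodel through `θ` whose score at `t = 0` is
`φ s a s' + k s a * (r - r(s, a))` per transition. -/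
def tiltedParam (v : S → Action → ℝ≥0) (θ : Param S) (φ : S → Action → S → ℝ)
    (k : S → Action → ℝ) (t : ℝ) : Param S :=
  (fun s a s' => θ.1 s a s' * (1 + t * φ s a s'), fun s a => θ.2 s a + t * k s a * v s a)

/-- The likelihood ratio of one transition between `tiltedParam v θ φ k t` and `θ`. -/
noncomputable def stepRatio (v : S → Action → ℝ≥0) (θ : Param S) (φ : S → Action → S → ℝ)
    (k : S → Action → ℝ) (t : ℝ) (x : S × Action × S × ℝ) : ℝ :=
  (1 + t * φ x.1 x.2.1 x.2.2.1) *
    gaussianShift (θ.2 x.1 x.2.1) (v x.1 x.2.1) (t * k x.1 x.2.1) x.2.2.2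

/-- The likelihood ratio of a trajectory between `tiltedParam v θ φ k t` and `θ`. -/
noncomputable def likelihoodRatio (v : S → Action → ℝ≥0) (θ : Param S) (φ : S → Action → S → ℝ)
    (k : S → Action → ℝ) (t : ℝ) {T : ℕ} (τ : Trajectory S T) : ℝ :=
  ∏ i, stepRatio v θ φ k t (τ i)

variable {v : S → Action → ℝ≥0} {θ : Param S} {φ : S → Action → S → ℝ} {k : S → Action → ℝ} {t : ℝ}

lemma likelihoodRatio_nonneg (hφ : ∀ s a s', 0 ≤ 1 + t * φ s a s') {T : ℕ}
    (τ : Trajectory S T) : 0 ≤ likelihoodRatio v θ φ k t τ :=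
  Finset.prod_nonneg fun _ _ => mul_nonneg (hφ _ _ _) (gaussianShift_nonneg _ _ _ _)

variable [Fintype S]

lemma tiltedParam_mem_paramSpace (hθ : θ ∈ paramSpace S)
    (hφ0 : ∀ s a, ∑ s', θ.1 s a s' * φ s a s' = 0) (hφ : ∀ s a s', 0 ≤ 1 + t * φ s a s') :
    tiltedParam v θ φ k t ∈ paramSpace S := by
  refine ⟨fun s a s' => mul_nonneg (hθ.1 s a s') (hφ s a s'), fun s a => ?_⟩
  have : ∀ s', θ.1 s a s' * (1 + t * φ s a s') = θ.1 s a s' + t * (θ.1 s a s' * φ s a s') :=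
    fun s' => by ring
  simp only [tiltedParam, this]
  rw [Finset.sum_add_distrib, ← Finset.mul_sum, hφ0, hθ.2, mul_zero, add_zero]

/-- For small `t` the tilted transition probabilities stay nonnegative. -/
lemma eventually_one_add_mul_nonneg (φ : S → Action → S → ℝ) :
    ∀ᶠ t in 𝓝 (0 : ℝ), ∀ s a s', 0 ≤ 1 + t * φ s a s' := by
  simp only [Filter.eventually_all]
  intro s a s'
  have h : Filter.Tendsto (fun t : ℝ => 1 + t * φ s a s') (𝓝 0) (𝓝 1) := by
    have : Continuous fun t : ℝ => 1 + t * φ s a s' := by fun_prop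
    simpa using this.tendsto 0
  filter_upwards [h.eventually (lt_mem_nhds zero_lt_one)] with t ht using ht.le

variable [MeasurableSpace S] [MeasurableSingletonClass S]

lemma measurable_stepRatio : Measurable (stepRatio v θ φ k t) := by
  have h1 : Measurable fun x : S × Action × S × ℝ => φ x.1 x.2.1 x.2.2.1 :=
    (Measurable.of_discrete (f := fun p : S × Action × S => φ p.1 p.2.1 p.2.2)).comp
      (g := fun p : S × Action × S => φ p.1 p.2.1 p.2.2)
      (f := fun x : S × Action × S × ℝ => (x.1, x.2.1, x.2.2.1)) (by fun_prop)
  have h2 (f : S → Action → ℝ) : Measurable fun x : S × Action × S × ℝ => f x.1 x.2.1 :=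
    (Measurable.of_discrete (f := fun p : S × Action => f p.1 p.2)).comp
      (g := fun p : S × Action => f p.1 p.2)
      (f := fun x : S × Action × S × ℝ => (x.1, x.2.1)) (by fun_prop)
  have hm := h2 θ.2
  have hk := h2 k
  have hv := h2 fun s a => (v s a : ℝ)
  unfold stepRatio gaussianShift
  fun_prop

lemma measurable_likelihoodRatio {T : ℕ} :
    Measurable fun τ : Trajectory S T => likelihoodRatio v θ φ k t τ :=
  Finset.measurable_prod _ fun i _ => measurable_stepRatio.comp (measurable_pi_apply i)

lemma trajectoryLaw_tiltedParam (hθ : θ ∈ paramSpace S) (hφ : ∀ s a s', 0 ≤ 1 + t * φ s a s')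
    {π : Policy S} (hπ : IsPolicy π) {μ : S → ℝ} (hμ : ∀ s, 0 ≤ μ s) (T : ℕ) :
    trajectoryLaw v (tiltedParam v θ φ k t) π μ T =
      (trajectoryLaw v θ π μ T).withDensity
        fun τ => ENNReal.ofReal (likelihoodRatio v θ φ k t τ) := by
  unfold trajectoryLaw
  rw [withDensity_finset_sum_measure]
  refine Finset.sum_congr rfl fun s _ => ?_
  rw [withDensity_finset_sum_measure]
  refine Finset.sum_congr rfl fun a _ => ?_
  rw [withDensity_smul_measure,
    ← map_withDensity_comp _ (measurable_trajectory_of_rewards s a)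
      measurable_likelihoodRatio.ennreal_ofReal]
  have hpath : pathProb (tiltedParam v θ φ k t) π μ s a =
      pathProb θ π μ s a * ∏ i, (1 + t * φ (s i.castSucc) (a i) (s i.succ)) := by
    simp only [pathProb, tiltedParam]
    rw [mul_assoc, ← Finset.prod_mul_distrib]
    congr 1
    exact Finset.prod_congr rfl fun i _ => by ring
  have hratio : (fun τ : Trajectory S T => ENNReal.ofReal (likelihoodRatio v θ φ k t τ)) ∘
        (fun (r : Fin T → ℝ) (i : Fin T) => (s i.castSucc, a i, s i.succ, r i)) =
      ENNReal.ofReal (∏ i, (1 + t * φ (s i.castSucc) (a i) (s i.succ))) •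
        fun r : Fin T → ℝ => ∏ i, ENNReal.ofReal (gaussianShift (θ.2 (s i.castSucc) (a i))
          (v (s i.castSucc) (a i)) (t * k (s i.castSucc) (a i)) (r i)) := by
    funext r
    simp only [Function.comp_apply, likelihoodRatio, stepRatio, Pi.smul_apply, smul_eq_mul]
    rw [Finset.prod_mul_distrib, ENNReal.ofReal_mul (Finset.prod_nonneg fun _ _ => hφ _ _ _),
      ENNReal.ofReal_prod_of_nonneg fun _ _ => gaussianShift_nonneg _ _ _ _]
  have hpi := pi_withDensity_eq
    (fun i => gaussianReal (θ.2 (s i.castSucc) (a i)) (v (s i.castSucc) (a i)))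
    (fun i => gaussianReal ((tiltedParam v θ φ k t).2 (s i.castSucc) (a i))
      (v (s i.castSucc) (a i)))
    (fun i x => ENNReal.ofReal (gaussianShift (θ.2 (s i.castSucc) (a i))
          (v (s i.castSucc) (a i)) (t * k (s i.castSucc) (a i)) x))
    (fun i => (measurable_gaussianShift _ _ _).ennreal_ofReal)
    (fun i => gaussianReal_shift_eq_withDensity _ _ _)
  rw [hpath, hratio, withDensity_smul _ (by
      exact Finset.measurable_prod _ fun i _ =>
        ((measurable_gaussianShift _ _ _).ennreal_ofReal).comp (measurable_pi_apply i)),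
    ← hpi, Measure.map_smul, smul_smul, ENNReal.ofReal_mul (pathProb_nonneg hθ hπ hμ s a)]

/-- The factor of `E[L²]` contributed by one transition, where `L` is the likelihood ratio. -/
noncomputable def stepSecondMoment (v : S → Action → ℝ≥0) (φ : S → Action → S → ℝ)
    (k : S → Action → ℝ) (t : ℝ) (s : S) (a : Action) (s' : S) : ℝ :=
  (1 + t * φ s a s') ^ 2 * Real.exp ((t * k s a) ^ 2 * v s a)

omit [Fintype S] [MeasurableSpace S] [MeasurableSingletonClass S] in
lemma integrable_likelihoodRatio_sq_rewards {T : ℕ} (s : Fin (T + 1) → S) (a : Fin T → Action) :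
    Integrable (fun r : Fin T → ℝ =>
        likelihoodRatio v θ φ k t (fun i => (s i.castSucc, a i, s i.succ, r i)) ^ 2)
      (Measure.pi fun i => gaussianReal (θ.2 (s i.castSucc) (a i)) (v (s i.castSucc) (a i))) := by
  simp only [likelihoodRatio, ← Finset.prod_pow]
  refine Integrable.fintype_prod_dep (f := fun i r =>
    stepRatio v θ φ k t (s i.castSucc, a i, s i.succ, r) ^ 2) fun i => ?_
  simp only [stepRatio, mul_pow]
  exact (integrable_gaussianShift_sq _ _ _).const_mul _

omit [Fintype S] [MeasurableSpace S] [MeasurableSingletonClass S] in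
lemma integral_likelihoodRatio_sq_rewards {T : ℕ} (s : Fin (T + 1) → S) (a : Fin T → Action) :
    ∫ r : Fin T → ℝ, likelihoodRatio v θ φ k t (fun i => (s i.castSucc, a i, s i.succ, r i)) ^ 2
      ∂(Measure.pi fun i => gaussianReal (θ.2 (s i.castSucc) (a i)) (v (s i.castSucc) (a i))) =
    ∏ i, stepSecondMoment v φ k t (s i.castSucc) (a i) (s i.succ) := by
  simp only [likelihoodRatio, ← Finset.prod_pow]
  rw [integral_fintype_prod_eq_prod (f := fun i r =>
    stepRatio v θ φ k t (s i.castSucc, a i, s i.succ, r) ^ 2)]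
  refine Finset.prod_congr rfl fun i _ => ?_
  simp only [stepRatio, mul_pow]
  rw [integral_const_mul, integral_gaussianShift_sq, stepSecondMoment, mul_pow]

lemma memLp_likelihoodRatio (π : Policy S) (μ : S → ℝ) (T : ℕ) :
    MemLp (fun τ : Trajectory S T => likelihoodRatio v θ φ k t τ) 2
      (trajectoryLaw v θ π μ T) :=
  (memLp_two_iff_integrable_sq measurable_likelihoodRatio.aestronglyMeasurable).2
    (integrable_trajectoryLaw (measurable_likelihoodRatio.pow_const 2)
      fun s a => integrable_likelihoodRatio_sq_rewards s a)

lemma integral_likelihoodRatio_sq [DecidableEq S] (hθ : θ ∈ paramSpace S)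
    {π : Policy S} (hπ : IsPolicy π) {μ : S → ℝ} (hμ : ∀ s, 0 ≤ μ s) (T : ℕ) :
    ∫ τ, likelihoodRatio v θ φ k t τ ^ 2 ∂(trajectoryLaw v θ π μ T) =
      μ ⬝ᵥ ((Matrix.of fun s s' => ∑ a, π s a * θ.1 s a s' *
        stepSecondMoment v φ k t s a s') ^ T *ᵥ 1) := by
  rw [integral_trajectoryLaw hθ hπ hμ (measurable_likelihoodRatio.pow_const 2)
    fun s a => integrable_likelihoodRatio_sq_rewards s a, ← sum_pathProb_mul_eq]
  simp only [integral_likelihoodRatio_sq_rewards]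

end Tilt

/-! ### The second-order expansion of the `χ²`-divergence -/

section ChiSq

variable {S : Type*} [Fintype S] [DecidableEq S]

/-- If `M t 1 = 1 + t² b + o(t²)` and `μ` is stationary for the limit `M₀` of `M t`, then
`μ M(t)ⁿ 1 = μ 1 + n t² (μ b) + o(t²)`: each factor contributes `μ b`. -/
lemma tendsto_dotProduct_pow_mulVec_one {μ b : S → ℝ} {M : ℝ → Matrix S S ℝ} {M₀ : Matrix S S ℝ}
    (hμ : μ ᵥ* M₀ = μ) (hM : Filter.Tendsto M (𝓝[≠] 0) (𝓝 M₀))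
    (hb : Filter.Tendsto (fun t => (t ^ 2)⁻¹ • (M t *ᵥ 1 - 1)) (𝓝[≠] 0) (𝓝 b)) (n : ℕ) :
    Filter.Tendsto (fun t => (t ^ 2)⁻¹ * (μ ⬝ᵥ (M t ^ n *ᵥ 1) - ∑ s, μ s)) (𝓝[≠] 0)
      (𝓝 (n * (μ ⬝ᵥ b))) := by
  induction n with
  | zero => simp [dotProduct]
  | succ n ih =>
    have hpow : ∀ m : ℕ, μ ᵥ* M₀ ^ m = μ := by
      intro m
      induction m with
      | zero => simp
      | succ m ihm => rw [pow_succ, ← Matrix.vecMul_vecMul, ihm, hμ]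
    have hcont : Continuous fun p : Matrix S S ℝ × (S → ℝ) => μ ⬝ᵥ (p.1 ^ n *ᵥ p.2) :=
      continuous_const.dotProduct ((continuous_fst.pow n).matrix_mulVec continuous_snd)
    have h := (hcont.tendsto (M₀, b)).comp (hM.prodMk_nhds hb)
    have hlim : μ ⬝ᵥ (M₀ ^ n *ᵥ b) = μ ⬝ᵥ b := by rw [Matrix.dotProduct_mulVec, hpow]
    simp only [hlim] at h
    convert h.add ih using 2 with t
    · simp only [Function.comp_apply, Matrix.mulVec_smul, dotProduct_smul, Matrix.mulVec_sub,
        dotProduct_sub, smul_eq_mul, pow_succ (M t), ← Matrix.mulVec_mulVec]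
      ring
    · push_cast
      ring

lemma tendsto_chiSq_div_sq {v : S → Action → ℝ≥0} {θ : Param S} (hθ : θ ∈ paramSpace S)
    {φ : S → Action → S → ℝ} (hφ0 : ∀ s a, ∑ s', θ.1 s a s' * φ s a s' = 0)
    (k : S → Action → ℝ) {π : Policy S} (hπ : IsPolicy π) {μ : S → ℝ}
    (hμ : IsStationary μ (transitionMatrix θ π)) (T : ℕ) :
    Filter.Tendsto (fun t : ℝ => (t ^ 2)⁻¹ * (μ ⬝ᵥ ((Matrix.of fun s s' => ∑ a,
        π s a * θ.1 s a s' * stepSecondMoment v φ k t s a s') ^ T *ᵥ 1) - 1)) (𝓝[≠] 0)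
      (𝓝 (T * ∑ s, μ s * ∑ a, π s a *
        (∑ s', θ.1 s a s' * φ s a s' ^ 2 + k s a ^ 2 * v s a))) := by
  rw [← hμ.sum_eq_one]
  refine tendsto_dotProduct_pow_mulVec_one (b := fun s => ∑ a, π s a *
        (∑ s', θ.1 s a s' * φ s a s' ^ 2 + k s a ^ 2 * v s a)) hμ.stationary ?_ ?_ T
  · have hc : Continuous fun t : ℝ => (Matrix.of fun s s' => ∑ a,
        π s a * θ.1 s a s' * stepSecondMoment v φ k t s a s' : Matrix S S ℝ) := by
      refine continuous_matrix fun s s' => ?_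
      simp only [Matrix.of_apply, stepSecondMoment]
      fun_prop
    have h0 : (Matrix.of fun s s' => ∑ a, π s a * θ.1 s a s' * stepSecondMoment v φ k 0 s a s' :
        Matrix S S ℝ) = transitionMatrix θ π := by
      ext s s'
      simp [stepSecondMoment, transitionMatrix, mul_comm]
    rw [← h0]
    exact (hc.tendsto 0).mono_left nhdsWithin_le_nhds
  · refine tendsto_pi_nhds.2 fun s => ?_
    -- The row sums depend on `t` only through `u = t ^ 2`, and are differentiable in `u`.
    set h : ℝ → ℝ := fun u => ∑ a, π s a *
      ((1 + u * ∑ s', θ.1 s a s' * φ s a s' ^ 2) * Real.exp (u * (k s a ^ 2 * v s a))) with hh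
    have hrow : ∀ t : ℝ, ((Matrix.of fun s s' => ∑ a,
        π s a * θ.1 s a s' * stepSecondMoment v φ k t s a s' : Matrix S S ℝ) *ᵥ 1) s
          = h (t ^ 2) := by
      intro t
      simp only [Matrix.mulVec, dotProduct, Matrix.of_apply, Pi.one_apply, mul_one, hh]
      rw [Finset.sum_comm]
      refine Finset.sum_congr rfl fun a _ => ?_
      have hs : ∀ s', π s a * θ.1 s a s' * stepSecondMoment v φ k t s a s' =
          π s a * Real.exp (t ^ 2 * (k s a ^ 2 * v s a)) * (θ.1 s a s' +
            2 * t * (θ.1 s a s' * φ s a s') + t ^ 2 * (θ.1 s a s' * φ s a s' ^ 2)) := by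
        intro s'
        rw [stepSecondMoment, mul_pow, mul_assoc (t ^ 2)]
        ring
      simp_rw [hs]
      rw [← Finset.mul_sum, Finset.sum_add_distrib, Finset.sum_add_distrib, ← Finset.mul_sum,
        ← Finset.mul_sum, hφ0, hθ.2]
      ring
    have h0 : h 0 = 1 := by simpa [hh] using hπ.sum_eq_one s
    have hd : HasDerivAt h (∑ a, π s a *
        (∑ s', θ.1 s a s' * φ s a s' ^ 2 + k s a ^ 2 * v s a)) 0 := by
      refine HasDerivAt.fun_sum fun a _ => HasDerivAt.const_mul _ ?_
      have h1 : HasDerivAt (fun u : ℝ => 1 + u * ∑ s', θ.1 s a s' * φ s a s' ^ 2)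
          (1 * ∑ s', θ.1 s a s' * φ s a s' ^ 2) 0 :=
        ((hasDerivAt_id (0 : ℝ)).mul_const _).const_add 1
      have h2 : HasDerivAt (fun u : ℝ => Real.exp (u * (k s a ^ 2 * v s a)))
          (Real.exp (0 * (k s a ^ 2 * v s a)) * (1 * (k s a ^ 2 * v s a))) 0 :=
        ((hasDerivAt_id (0 : ℝ)).mul_const _).exp
      exact (h1.mul h2).congr_deriv (by simp)
    have hsq : Filter.Tendsto (fun t : ℝ => t ^ 2) (𝓝[≠] 0) (𝓝[≠] 0) := by
      refine tendsto_nhdsWithin_iff.2 ⟨?_, ?_⟩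
      · have : Filter.Tendsto (fun t : ℝ => t ^ 2) (𝓝 0) (𝓝 0) := by
          simpa using (continuous_pow 2).tendsto (0 : ℝ)
        exact this.mono_left nhdsWithin_le_nhds
      · filter_upwards [self_mem_nhdsWithin] with t ht using pow_ne_zero 2 ht
    have := (hasDerivAt_iff_tendsto_slope_zero.1 hd).comp hsq
    refine this.congr fun t => ?_
    simp only [Function.comp_apply, Pi.smul_apply, Pi.sub_apply, hrow, zero_add, h0, Pi.one_apply]

end ChiSq

/-! ### Value functions and the Bellman equation -/

section Value

variable {S : Type*} [Fintype S]

omit [Fintype S] in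
lemma treatmentPolicy_eq_armPolicy : (treatmentPolicy : Policy S) = armPolicy true := rfl

omit [Fintype S] in
lemma controlPolicy_eq_armPolicy : (controlPolicy : Policy S) = armPolicy false := rfl

omit [Fintype S] in
lemma transitionMatrix_armPolicy (θ : Param S) (a : Action) :
    transitionMatrix θ (armPolicy a) = Matrix.of fun s s' => θ.1 s a s' := by
  ext s s'
  simp [transitionMatrix, armPolicy]

lemma abs_transitionMatrix_mulVec_le {θ : Param S} (hθ : θ ∈ paramSpace S) {π : Policy S}
    (hπ : IsPolicy π) (w : S → ℝ) (s : S) : |(transitionMatrix θ π *ᵥ w) s| ≤ ‖w‖ := by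
  have hnn : ∀ s', 0 ≤ transitionMatrix θ π s s' := fun s' => by
    simp only [transitionMatrix, Matrix.of_apply]
    exact Finset.sum_nonneg fun a _ => mul_nonneg (hθ.1 _ _ _) (hπ.nonneg _ _)
  have hone : ∑ s', transitionMatrix θ π s s' = 1 := by
    simpa [Matrix.mulVec, dotProduct] using congrFun (transitionMatrix_mulVec_one hθ hπ) s
  calc |(transitionMatrix θ π *ᵥ w) s| ≤ ∑ s', |transitionMatrix θ π s s' * w s'| :=
        Finset.abs_sum_le_sum_abs _ _
    _ ≤ ∑ s', transitionMatrix θ π s s' * ‖w‖ := by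
        refine Finset.sum_le_sum fun s' _ => ?_
        rw [abs_mul, abs_of_nonneg (hnn s')]
        exact mul_le_mul_of_nonneg_left (norm_le_pi_norm w s') (hnn s')
    _ = ‖w‖ := by rw [← Finset.sum_mul, hone, one_mul]

lemma norm_transitionMatrix_mulVec_le {θ : Param S} (hθ : θ ∈ paramSpace S) {π : Policy S}
    (hπ : IsPolicy π) (w : S → ℝ) : ‖transitionMatrix θ π *ᵥ w‖ ≤ ‖w‖ :=
  (pi_norm_le_iff_of_nonneg (norm_nonneg w)).2 fun s => abs_transitionMatrix_mulVec_le hθ hπ w s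

/-- The sup-norm stability of the Bellman equation. -/
lemma norm_le_of_bellman {γ : ℝ} (hγ0 : 0 ≤ γ) (hγ1 : γ < 1) {θ : Param S}
    (hθ : θ ∈ paramSpace S) {π : Policy S} (hπ : IsPolicy π) {w r : S → ℝ}
    (hw : w = r + γ • (transitionMatrix θ π *ᵥ w)) : ‖w‖ ≤ (1 - γ)⁻¹ * ‖r‖ := by
  have h1 : ‖w‖ ≤ ‖r‖ + γ * ‖w‖ :=
    calc ‖w‖ = ‖r + γ • (transitionMatrix θ π *ᵥ w)‖ := by rw [← hw]
      _ ≤ ‖r‖ + ‖γ • (transitionMatrix θ π *ᵥ w)‖ := norm_add_le _ _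
      _ ≤ ‖r‖ + γ * ‖w‖ := by
        rw [norm_smul, Real.norm_of_nonneg hγ0]
        gcongr
        exact norm_transitionMatrix_mulVec_le hθ hπ w
  rw [inv_mul_eq_div, le_div_iff₀ (by linarith)]
  linarith

variable [DecidableEq S]

lemma isUnit_one_sub_smul_transitionMatrix {γ : ℝ} (hγ0 : 0 ≤ γ) (hγ1 : γ < 1) {θ : Param S}
    (hθ : θ ∈ paramSpace S) {π : Policy S} (hπ : IsPolicy π) :
    IsUnit (1 - γ • transitionMatrix θ π) := by
  rw [← Matrix.mulVec_injective_iff_isUnit]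
  refine (injective_iff_map_eq_zero (1 - γ • transitionMatrix θ π).mulVecLin).2 fun w hw => ?_
  rw [Matrix.mulVecLin_apply, Matrix.sub_mulVec, Matrix.one_mulVec, Matrix.smul_mulVec,
    sub_eq_zero] at hw
  have := norm_le_of_bellman hγ0 hγ1 hθ hπ (w := w) (r := 0) (by rw [zero_add]; exact hw)
  rw [norm_zero, mul_zero] at this
  exact norm_le_zero_iff.1 this

variable [MeasurableSpace S] [MeasurableSingletonClass S]

lemma value_eq_tsum (γ : ℝ) (v : S → Action → ℝ≥0) {θ : Param S} (hθ : θ ∈ paramSpace S)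
    {π : Policy S} (hπ : IsPolicy π) (s : S) :
    value γ v θ π s =
      ∑' i : ℕ, γ ^ i * (transitionMatrix θ π ^ i *ᵥ fun s => ∑ a, π s a * θ.2 s a) s := by
  unfold value
  congr 1
  funext i
  congr 1
  have hmeas : Measurable fun τ : Trajectory S (i + 1) =>
      θ.2 (τ (Fin.last i)).1 (τ (Fin.last i)).2.1 :=
    (Measurable.of_discrete (f := fun p : S × Action => θ.2 p.1 p.2)).comp
      (g := fun p : S × Action => θ.2 p.1 p.2)
      (f := fun τ : Trajectory S (i + 1) => ((τ (Fin.last i)).1, (τ (Fin.last i)).2.1))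
      (by fun_prop)
  have hnn : ∀ s', (0 : ℝ) ≤ (Pi.single s 1 : S → ℝ) s' := fun s' => by
    by_cases h : s' = s
    · subst h; simp
    · simp [Pi.single_eq_of_ne h]
  rw [integral_trajectoryLaw hθ hπ hnn hmeas fun s a =>
    integrable_const (θ.2 (s (Fin.last i).castSucc) (a (Fin.last i)))]
  simp only [integral_const, probReal_univ, smul_eq_mul, one_mul]
  have h1 := sum_paths_succ (Pi.single s 1) (fun s a s' => π s a * θ.1 s a s')
    (fun s a _ => θ.2 s a) i
  have h2 : ∀ s : S, ∑ a, ∑ s', π s a * θ.1 s a s' * θ.2 s a = ∑ a, π s a * θ.2 s a := by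
    intro s
    refine Finset.sum_congr rfl fun a _ => ?_
    rw [← Finset.sum_mul, ← Finset.mul_sum, hθ.2, mul_one]
  simp only [h2] at h1
  have h3 := sum_paths_eq_vecMul_pow (Pi.single s 1) (fun s a s' => π s a * θ.1 s a s')
    (fun s => ∑ a, π s a * θ.2 s a) i
  have hM : (Matrix.of fun s s' => ∑ a, π s a * θ.1 s a s') = transitionMatrix θ π := by
    ext s s'
    simp [transitionMatrix, mul_comm]
  rw [hM, single_one_dotProduct] at h3
  rw [← h3, ← h1]
  rfl

/-- The Bellman equation `V = r + γ P V`. -/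
lemma value_bellman {γ : ℝ} (hγ0 : 0 ≤ γ) (hγ1 : γ < 1) (v : S → Action → ℝ≥0) {θ : Param S}
    (hθ : θ ∈ paramSpace S) {π : Policy S} (hπ : IsPolicy π) :
    value γ v θ π = (fun s => ∑ a, π s a * θ.2 s a) +
      γ • (transitionMatrix θ π *ᵥ value γ v θ π) := by
  set r : S → ℝ := fun s => ∑ a, π s a * θ.2 s a with hr
  set P := transitionMatrix θ π with hP
  have hbd : ∀ i : ℕ, ‖P ^ i *ᵥ r‖ ≤ ‖r‖ := by
    intro i
    induction i with
    | zero => simp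
    | succ i ih =>
      rw [pow_succ', ← Matrix.mulVec_mulVec]
      exact (norm_transitionMatrix_mulVec_le hθ hπ _).trans ih
  have hsum : ∀ s, Summable fun i : ℕ => γ ^ i * (P ^ i *ᵥ r) s := by
    intro s
    refine Summable.of_norm_bounded
      ((summable_geometric_of_lt_one hγ0 hγ1).mul_right ‖r‖) fun i => ?_
    rw [norm_mul, norm_pow, Real.norm_of_nonneg hγ0]
    exact mul_le_mul_of_nonneg_left ((norm_le_pi_norm _ s).trans (hbd i)) (pow_nonneg hγ0 i)
  have hval : ∀ s, value γ v θ π s = ∑' i : ℕ, γ ^ i * (P ^ i *ᵥ r) s := fun s =>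
    value_eq_tsum γ v hθ hπ s
  funext s
  rw [hval s, (hsum s).tsum_eq_zero_add]
  simp only [Pi.add_apply, Pi.smul_apply, smul_eq_mul, Matrix.mulVec, dotProduct, pow_zero, one_mul]
  have h0 : (∑ s', (1 : Matrix S S ℝ) s s' * r s') = r s := by
    simpa [Matrix.mulVec, dotProduct] using congrFun (Matrix.one_mulVec r) s
  rw [h0]
  congr 1
  simp only [hval]
  simp_rw [← tsum_mul_left]
  rw [← Summable.tsum_finsetSum fun s' _ => ((hsum s').mul_left _), ← tsum_mul_left]
  congr 1
  funext i
  have h1 : (∑ s', (P ^ (i + 1)) s s' * r s') = (P ^ (i + 1) *ᵥ r) s := rfl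
  rw [h1, pow_succ' P i, ← Matrix.mulVec_mulVec, pow_succ' γ i]
  simp only [Matrix.mulVec, dotProduct]
  rw [Finset.mul_sum, Finset.mul_sum]
  exact Finset.sum_congr rfl fun s' _ => by ring

end Value

/-! ### Derivatives of the value functions along the submodel -/

section Derivative

variable {S : Type*} [Fintype S] [DecidableEq S] [MeasurableSpace S] [MeasurableSingletonClass S]

lemma value_armPolicy_bellman {γ : ℝ} (hγ0 : 0 ≤ γ) (hγ1 : γ < 1) (v : S → Action → ℝ≥0)
    {θ : Param S} (hθ : θ ∈ paramSpace S) (a : Action) :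
    value γ v θ (armPolicy a) = (fun s => θ.2 s a) +
      γ • (transitionMatrix θ (armPolicy a) *ᵥ value γ v θ (armPolicy a)) := by
  have h := value_bellman hγ0 hγ1 v hθ (armPolicy_isPolicy a)
  have hr : (fun s => ∑ b, armPolicy a s b * θ.2 s b) = fun s => θ.2 s a := by
    funext s
    simp [armPolicy]
  rwa [hr] at h

lemma tendsto_value_tiltedParam {γ : ℝ} (hγ0 : 0 ≤ γ) (hγ1 : γ < 1) {v : S → Action → ℝ≥0}
    {θ : Param S} (hθ : θ ∈ paramSpace S) {φ : S → Action → S → ℝ}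
    (hφ0 : ∀ s a, ∑ s', θ.1 s a s' * φ s a s' = 0) (k : S → Action → ℝ) (a : Action) :
    Filter.Tendsto (fun t => value γ v (tiltedParam v θ φ k t) (armPolicy a)) (𝓝 0)
      (𝓝 (value γ v θ (armPolicy a))) := by
  set V := value γ v θ (armPolicy a) with hV
  have hVb := value_armPolicy_bellman hγ0 hγ1 v hθ a
  rw [← hV] at hVb
  set g : S → ℝ := fun s => k s a * v s a + γ * ∑ s', θ.1 s a s' * φ s a s' * V s' with hg
  rw [tendsto_iff_norm_sub_tendsto_zero]
  have hlim : Filter.Tendsto (fun t : ℝ => (1 - γ)⁻¹ * ‖t • g‖) (𝓝 0) (𝓝 0) := by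
    have : Continuous fun t : ℝ => (1 - γ)⁻¹ * ‖t • g‖ := by fun_prop
    simpa using this.tendsto 0
  refine squeeze_zero' (Filter.Eventually.of_forall fun t => norm_nonneg _) ?_ hlim
  filter_upwards [eventually_one_add_mul_nonneg φ] with t ht
  have hθt := tiltedParam_mem_paramSpace (v := v) (k := k) hθ hφ0 ht
  refine norm_le_of_bellman hγ0 hγ1 hθt (armPolicy_isPolicy a) ?_
  have hVt := value_armPolicy_bellman hγ0 hγ1 v hθt a
  set W := value γ v (tiltedParam v θ φ k t) (armPolicy a)
  funext s
  have e1 := congrFun hVb s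
  have e2 := congrFun hVt s
  simp only [transitionMatrix_armPolicy, Pi.add_apply, Pi.smul_apply, smul_eq_mul, Matrix.mulVec,
    dotProduct, Matrix.of_apply, tiltedParam, Pi.sub_apply, hg] at e1 e2 ⊢
  have e3 : ∑ s', θ.1 s a s' * (1 + t * φ s a s') * (W s' - V s') =
      ∑ s', θ.1 s a s' * (1 + t * φ s a s') * W s' - ∑ s', θ.1 s a s' * V s' -
        t * ∑ s', θ.1 s a s' * φ s a s' * V s' := by
    rw [Finset.mul_sum, ← Finset.sum_sub_distrib, ← Finset.sum_sub_distrib]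
    exact Finset.sum_congr rfl fun s' _ => by ring
  rw [e3]
  linear_combination e2 - e1

/-- The directional derivative of `x ⬝ V` along the submodel, from the perturbation identity
`(I - γ P) (V_t - V) = (r_t - r) + γ (P_t - P) V_t`. -/
lemma tendsto_slope_dotProduct_value {γ : ℝ} (hγ0 : 0 ≤ γ) (hγ1 : γ < 1) {v : S → Action → ℝ≥0}
    {θ : Param S} (hθ : θ ∈ paramSpace S) {φ : S → Action → S → ℝ}
    (hφ0 : ∀ s a, ∑ s', θ.1 s a s' * φ s a s' = 0) (k : S → Action → ℝ) (a : Action)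
    (x : S → ℝ) :
    Filter.Tendsto (fun t => t⁻¹ * (x ⬝ᵥ (value γ v (tiltedParam v θ φ k t) (armPolicy a) -
        value γ v θ (armPolicy a)))) (𝓝[≠] 0)
      (𝓝 (∑ s, (((1 - γ • transitionMatrix θ (armPolicy a))⁻¹)ᵀ *ᵥ x) s *
        (k s a * v s a + γ * ∑ s', θ.1 s a s' * φ s a s' * value γ v θ (armPolicy a) s'))) := by
  set V := value γ v θ (armPolicy a) with hV
  have hVb := value_armPolicy_bellman hγ0 hγ1 v hθ a
  rw [← hV] at hVb
  set R := (1 - γ • transitionMatrix θ (armPolicy a))⁻¹ with hR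
  have hunit := isUnit_one_sub_smul_transitionMatrix hγ0 hγ1 hθ (armPolicy_isPolicy a)
  set y := Rᵀ *ᵥ x with hy
  have hc : Continuous fun W : S → ℝ =>
      ∑ s, y s * (k s a * v s a + γ * ∑ s', θ.1 s a s' * φ s a s' * W s') := by fun_prop
  have hlim := ((hc.tendsto V).comp
    (tendsto_value_tiltedParam (v := v) hγ0 hγ1 hθ hφ0 k a)).mono_left
    (nhdsWithin_le_nhds (s := {0}ᶜ))
  refine hlim.congr' ?_
  filter_upwards [nhdsWithin_le_nhds (eventually_one_add_mul_nonneg φ), self_mem_nhdsWithin]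
    with t ht ht0
  have hθt := tiltedParam_mem_paramSpace (v := v) (k := k) hθ hφ0 ht
  have hVt := value_armPolicy_bellman hγ0 hγ1 v hθt a
  simp only [Function.comp_apply]
  set W := value γ v (tiltedParam v θ φ k t) (armPolicy a)
  have hstep : (1 - γ • transitionMatrix θ (armPolicy a)) *ᵥ (W - V) =
      t • fun s => k s a * v s a + γ * ∑ s', θ.1 s a s' * φ s a s' * W s' := by
    funext s
    have e1 := congrFun hVb s
    have e2 := congrFun hVt s
    rw [Matrix.sub_mulVec, Matrix.one_mulVec, Matrix.smul_mulVec]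
    simp only [transitionMatrix_armPolicy, Pi.add_apply, Pi.smul_apply, smul_eq_mul, Matrix.mulVec,
      dotProduct, Matrix.of_apply, tiltedParam, Pi.sub_apply] at e1 e2 ⊢
    have e3 : ∑ s', θ.1 s a s' * (W s' - V s') =
        ∑ s', θ.1 s a s' * (1 + t * φ s a s') * W s' - ∑ s', θ.1 s a s' * V s' -
          t * ∑ s', θ.1 s a s' * φ s a s' * W s' := by
      rw [Finset.mul_sum, ← Finset.sum_sub_distrib, ← Finset.sum_sub_distrib]
      exact Finset.sum_congr rfl fun s' _ => by ring
    rw [e3]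
    linear_combination e2 - e1
  have hinv : W - V = R *ᵥ ((1 - γ • transitionMatrix θ (armPolicy a)) *ᵥ (W - V)) := by
    rw [Matrix.mulVec_mulVec, hR,
      Matrix.nonsing_inv_mul _ ((Matrix.isUnit_iff_isUnit_det _).1 hunit), Matrix.one_mulVec]
  have hxy : ∀ w : S → ℝ, x ⬝ᵥ (R *ᵥ w) = y ⬝ᵥ w := fun w => by
    rw [hy, Matrix.mulVec_transpose, Matrix.dotProduct_mulVec]
  rw [hinv, hstep, hxy, dotProduct_smul, smul_eq_mul, inv_mul_cancel_left₀ ht0]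
  rfl

end Derivative

/-! ### The quadratic form of `Σ_AB` -/

section QuadraticForm

variable {S : Type*} [Fintype S] [DecidableEq S] [MeasurableSpace S]

/-- The conditional variance of `r + γ V(s')` given the state `s` and the action `a`. -/
def bellmanVariance (γ : ℝ) (v : S → Action → ℝ≥0) (θ : Param S) (V : S → ℝ) (s : S)
    (a : Action) : ℝ :=
  v s a + γ ^ 2 * (∑ s', θ.1 s a s' * V s' ^ 2 - (∑ s', θ.1 s a s' * V s') ^ 2)

lemma armCov_armPolicy (γ : ℝ) (v : S → Action → ℝ≥0) (θ : Param S) (μ : S → ℝ) (a : Action) :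
    armCov γ v θ μ (armPolicy a) = (1 - γ • transitionMatrix θ (armPolicy a))⁻¹ *
      Matrix.diagonal (fun s =>
        bellmanVariance γ v θ (value γ v θ (armPolicy a)) s a / μ s) *
      ((1 - γ • transitionMatrix θ (armPolicy a))⁻¹)ᵀ := by
  unfold armCov
  congr 3
  funext s
  rw [← add_div]
  congr 1
  have hv : policyVariance v (armPolicy a) s = v s a := by simp [policyVariance, armPolicy]
  set V := value γ v θ (armPolicy a)
  have hp : transitionMatrix θ (armPolicy a) s = θ.1 s a := by
    rw [transitionMatrix_armPolicy]
    rfl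
  rw [hv, bellmanVariance, transitionCov, hp, Matrix.sub_mulVec, dotProduct_sub, mul_sub]
  congr 2
  · simp only [dotProduct, Matrix.mulVec_diagonal, Pi.smul_apply, smul_eq_mul, Finset.mul_sum]
    exact Finset.sum_congr rfl fun s' _ => by ring
  · have : Matrix.vecMulVec (θ.1 s a) (θ.1 s a) *ᵥ (γ • V) =
        (∑ s', θ.1 s a s' * (γ * V s')) • θ.1 s a := by
      funext s'
      simp only [Matrix.mulVec, dotProduct, Matrix.vecMulVec_apply, Pi.smul_apply, smul_eq_mul,
        Finset.sum_mul]
      exact Finset.sum_congr rfl fun s'' _ => by ring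
    rw [this, dotProduct_smul]
    have h1 : ∑ s', θ.1 s a s' * (γ * V s') = γ * ∑ s', θ.1 s a s' * V s' := by
      rw [Finset.mul_sum]
      exact Finset.sum_congr rfl fun s' _ => by ring
    have h2 : (γ • V) ⬝ᵥ θ.1 s a = γ * ∑ s', θ.1 s a s' * V s' := by
      rw [← h1]
      exact Finset.sum_congr rfl fun s' _ => by simp [mul_comm]
    rw [h1, h2, smul_eq_mul]
    ring

lemma dotProduct_armCov_mulVec (γ : ℝ) (v : S → Action → ℝ≥0) (θ : Param S) (μ : S → ℝ)
    (a : Action) (x : S → ℝ) :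
    x ⬝ᵥ (armCov γ v θ μ (armPolicy a) *ᵥ x) =
      ∑ s, (((1 - γ • transitionMatrix θ (armPolicy a))⁻¹)ᵀ *ᵥ x) s ^ 2 *
        (bellmanVariance γ v θ (value γ v θ (armPolicy a)) s a / μ s) := by
  rw [armCov_armPolicy, ← Matrix.mulVec_mulVec, ← Matrix.mulVec_mulVec, Matrix.dotProduct_mulVec,
    ← Matrix.mulVec_transpose]
  simp only [dotProduct, Matrix.mulVec_diagonal]
  exact Finset.sum_congr rfl fun s _ => by ring

lemma isHermitian_armCov (γ : ℝ) (v : S → Action → ℝ≥0) (θ : Param S) (μ : S → ℝ)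
    (π : Policy S) : (armCov γ v θ μ π).IsHermitian := by
  rw [Matrix.IsHermitian, Matrix.conjTranspose_eq_transpose_of_trivial, armCov,
    Matrix.transpose_mul, Matrix.transpose_mul, Matrix.transpose_transpose,
    Matrix.diagonal_transpose, Matrix.mul_assoc]

omit [DecidableEq S] [MeasurableSpace S] in
lemma sum_mul_sub_mean_sq {θ : Param S} (hθ : θ ∈ paramSpace S) (V : S → ℝ) (s : S)
    (a : Action) :
    ∑ s', θ.1 s a s' * (V s' - ∑ s'', θ.1 s a s'' * V s'') ^ 2 =
      ∑ s', θ.1 s a s' * V s' ^ 2 - (∑ s', θ.1 s a s' * V s') ^ 2 := by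
  set m := ∑ s', θ.1 s a s' * V s' with hm
  have : ∀ s', θ.1 s a s' * (V s' - m) ^ 2 =
      θ.1 s a s' * V s' ^ 2 - 2 * m * (θ.1 s a s' * V s') + m ^ 2 * θ.1 s a s' :=
    fun s' => by ring
  simp_rw [this]
  rw [Finset.sum_add_distrib, Finset.sum_sub_distrib, ← Finset.mul_sum, ← Finset.mul_sum,
    hθ.2, ← hm]
  ring

omit [DecidableEq S] [MeasurableSpace S] in
lemma sum_mul_sub_mean_mul (θ : Param S) (V : S → ℝ) (s : S)
    (a : Action) :
    ∑ s', θ.1 s a s' * (V s' - ∑ s'', θ.1 s a s'' * V s'') * V s' =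
      ∑ s', θ.1 s a s' * V s' ^ 2 - (∑ s', θ.1 s a s' * V s') ^ 2 := by
  set m := ∑ s', θ.1 s a s' * V s' with hm
  have : ∀ s', θ.1 s a s' * (V s' - m) * V s' =
      θ.1 s a s' * V s' ^ 2 - m * (θ.1 s a s' * V s') :=
    fun s' => by ring
  simp_rw [this]
  rw [Finset.sum_sub_distrib, ← Finset.mul_sum, ← hm]
  ring

end QuadraticForm

/-! ### The Cramér–Rao bound in one direction -/

section CramerRao

variable {S : Type*} [Fintype S] [DecidableEq S] [MeasurableSpace S] [MeasurableSingletonClass S]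

omit [DecidableEq S] in
/-- An estimator with a second moment under `θ` is integrable under the nearby tilted parameters. -/
lemma integrable_trajectoryLaw_tiltedParam {v : S → Action → ℝ≥0} {θ : Param S}
    (hθ : θ ∈ paramSpace S) {φ : S → Action → S → ℝ} {k : S → Action → ℝ} {t : ℝ}
    (hφ : ∀ s a s', 0 ≤ 1 + t * φ s a s') {π : Policy S} (hπ : IsPolicy π) {μ : S → ℝ}
    (hμ : ∀ s, 0 ≤ μ s) {T : ℕ} {Z : Trajectory S T → ℝ}
    (hZ : MemLp Z 2 (trajectoryLaw v θ π μ T)) :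
    Integrable Z (trajectoryLaw v (tiltedParam v θ φ k t) π μ T) := by
  rw [trajectoryLaw_tiltedParam hθ hφ hπ hμ,
    integrable_withDensity_iff_integrable_smul' measurable_likelihoodRatio.ennreal_ofReal
      (Filter.Eventually.of_forall fun _ => ENNReal.ofReal_lt_top)]
  simp only [ENNReal.toReal_ofReal (likelihoodRatio_nonneg hφ _), smul_eq_mul]
  exact (memLp_likelihoodRatio π μ T).integrable_mul hZ

omit [Fintype S] [DecidableEq S] [MeasurableSpace S] [MeasurableSingletonClass S] in
lemma tiltedParam_sub (v : S → Action → ℝ≥0) (θ : Param S) (φ : S → Action → S → ℝ)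
    (k : S → Action → ℝ) (t : ℝ) :
    tiltedParam v θ φ k t - θ =
      t • ((fun s a s' => θ.1 s a s' * φ s a s', fun s a => k s a * v s a) : Param S) := by
  ext
  · simp [tiltedParam]
    ring
  · simp [tiltedParam]
    ring

omit [MeasurableSingletonClass S] in
/-- The bias of a locally unbiased estimator is `o(t)` along the tilted submodel. -/
lemma tendsto_bias_div {γ : ℝ} {v : S → Action → ℝ≥0} {θ : Param S} (hθ : θ ∈ paramSpace S)
    {φ : S → Action → S → ℝ} (hφ0 : ∀ s a, ∑ s', θ.1 s a s' * φ s a s' = 0) (k : S → Action → ℝ)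
    {μ : S → ℝ} {T : ℕ} {est : Trajectory S T → S → ℝ}
    (hloc : IsLocallyUnbiasedAt γ v μ est θ) (s : S) :
    Filter.Tendsto (fun t => t⁻¹ * (∫ τ, est τ s ∂(experimentLaw v μ T (tiltedParam v θ φ k t)) -
      ate γ v (tiltedParam v θ φ k t) s)) (𝓝[≠] 0) (𝓝 0) := by
  have hlim : Filter.Tendsto (fun t => tiltedParam v θ φ k t) (𝓝[≠] 0) (𝓝[paramSpace S] θ) := by
    refine tendsto_nhdsWithin_iff.2 ⟨?_, ?_⟩
    · rw [← tendsto_sub_nhds_zero_iff]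
      simp only [tiltedParam_sub]
      have hc : Continuous fun t : ℝ =>
          t • ((fun s a s' => θ.1 s a s' * φ s a s', fun s a => k s a * v s a) : Param S) := by
        fun_prop
      have h0 := hc.tendsto 0
      rw [zero_smul] at h0
      exact h0.mono_left nhdsWithin_le_nhds
    · filter_upwards [nhdsWithin_le_nhds (eventually_one_add_mul_nonneg φ)] with t ht
      exact tiltedParam_mem_paramSpace hθ hφ0 ht
  have h1 := (hloc s).2.comp_tendsto hlim
  have h2 : ((fun θ' => θ' - θ) ∘ fun t => tiltedParam v θ φ k t) =O[𝓝[≠] 0]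
      fun t : ℝ => t := by
    refine IsBigO.of_bound
      ‖((fun s a s' => θ.1 s a s' * φ s a s', fun s a => k s a * v s a) : Param S)‖
      (Filter.Eventually.of_forall fun t => ?_)
    simp only [Function.comp_apply, tiltedParam_sub, norm_smul]
    rw [mul_comm]
  refine (h1.trans_isBigO h2).tendsto_div_nhds_zero.congr fun t => ?_
  rw [div_eq_inv_mul]
  rfl

/-- The Cramér–Rao inequality for a linear functional of the estimator along the tilted submodel:
the squared derivative of the estimand is at most the variance times the Fisher information of
the `T` transitions. -/
lemma sq_derivative_le_variance_mul_information {γ : ℝ} {v : S → Action → ℝ≥0} {θ : Param S}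
    (hθ : θ ∈ paramSpace S) {φ : S → Action → S → ℝ}
    (hφ0 : ∀ s a, ∑ s', θ.1 s a s' * φ s a s' = 0) (k : S → Action → ℝ) {μ : S → ℝ}
    (hμ : IsStationary μ (transitionMatrix θ mixedPolicy)) {T : ℕ}
    {est : Trajectory S T → S → ℝ} (hL2 : ∀ s, MemLp (fun τ => est τ s) 2 (experimentLaw v μ T θ))
    (hloc : IsLocallyUnbiasedAt γ v μ est θ) (x : S → ℝ) {d : ℝ}
    (hd : Filter.Tendsto (fun t => t⁻¹ * (x ⬝ᵥ (ate γ v (tiltedParam v θ φ k t) - ate γ v θ)))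
      (𝓝[≠] 0) (𝓝 d)) :
    d ^ 2 ≤ Var[fun τ => ∑ s, x s * est τ s; experimentLaw v μ T θ] *
      (T * ∑ s, μ s * ∑ a, mixedPolicy s a *
        (∑ s', θ.1 s a s' * φ s a s' ^ 2 + k s a ^ 2 * v s a)) := by
  have hprob : IsProbabilityMeasure (experimentLaw v μ T θ) :=
    isProbabilityMeasure_trajectoryLaw v hθ mixedPolicy_isPolicy hμ.nonneg hμ.sum_eq_one T
  have hZ : MemLp (fun τ => ∑ s, x s * est τ s) 2 (experimentLaw v μ T θ) :=
    memLp_finsetSum _ fun s _ => (hL2 s).const_mul (x s)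
  have hint : ∀ θ' : Param S, (∀ s, Integrable (fun τ => est τ s) (experimentLaw v μ T θ')) →
      ∫ τ, ∑ s, x s * est τ s ∂(experimentLaw v μ T θ') =
        ∑ s, x s * ∫ τ, est τ s ∂(experimentLaw v μ T θ') := fun θ' h => by
    rw [integral_finsetSum _ fun s _ => (h s).const_mul (x s)]
    simp only [integral_const_mul]
  -- The difference quotient of the mean of the estimator has the limit `d` as well.
  have hslope : Filter.Tendsto (fun t => t⁻¹ *
      (∫ τ, ∑ s, x s * est τ s ∂(experimentLaw v μ T (tiltedParam v θ φ k t)) -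
        ∫ τ, ∑ s, x s * est τ s ∂(experimentLaw v μ T θ))) (𝓝[≠] 0) (𝓝 d) := by
    have hb := tendsto_finsetSum Finset.univ fun s (_ : s ∈ Finset.univ) =>
      (tendsto_bias_div hθ hφ0 k hloc s).const_mul (x s)
    have hsum := hd.add hb
    simp only [mul_zero, Finset.sum_const_zero, add_zero] at hsum
    refine hsum.congr' ?_
    filter_upwards [nhdsWithin_le_nhds (eventually_one_add_mul_nonneg φ)] with t ht
    rw [hint θ fun s => (hL2 s).integrable one_le_two, hint _ fun s =>
      integrable_trajectoryLaw_tiltedParam hθ ht mixedPolicy_isPolicy hμ.nonneg (hL2 s),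
      ← Finset.sum_sub_distrib, dotProduct, Finset.mul_sum, Finset.mul_sum,
      ← Finset.sum_add_distrib]
    refine Finset.sum_congr rfl fun s _ => ?_
    rw [(hloc s).1, Pi.sub_apply]
    ring
  refine le_of_tendsto_of_tendsto (hslope.pow 2)
    ((tendsto_chiSq_div_sq hθ hφ0 k mixedPolicy_isPolicy hμ T).const_mul _) ?_
  filter_upwards [nhdsWithin_le_nhds (eventually_one_add_mul_nonneg φ)] with t ht
  have hlaw : experimentLaw v μ T (tiltedParam v θ φ k t) = (experimentLaw v μ T θ).withDensity
      fun τ => ENNReal.ofReal (likelihoodRatio v θ φ k t τ) :=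
    trajectoryLaw_tiltedParam hθ ht mixedPolicy_isPolicy hμ.nonneg T
  have hprob' : IsProbabilityMeasure ((experimentLaw v μ T θ).withDensity
      fun τ => ENNReal.ofReal (likelihoodRatio v θ φ k t τ)) := by
    rw [← hlaw]
    exact isProbabilityMeasure_trajectoryLaw v (tiltedParam_mem_paramSpace hθ hφ0 ht)
      mixedPolicy_isPolicy hμ.nonneg hμ.sum_eq_one T
  have h := sq_integral_withDensity_sub_le hZ
    (memLp_likelihoodRatio (v := v) (θ := θ) (φ := φ) (k := k) (t := t) mixedPolicy μ T)
    measurable_likelihoodRatio fun τ => likelihoodRatio_nonneg ht τ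
  have hL : ∫ τ, likelihoodRatio v θ φ k t τ ^ 2 ∂(experimentLaw v μ T θ) = _ :=
    integral_likelihoodRatio_sq hθ mixedPolicy_isPolicy hμ.nonneg T
  rw [← hlaw, hL] at h
  rw [mul_pow, inv_pow, mul_left_comm]
  exact mul_le_mul_of_nonneg_left h (by positivity)

end CramerRao

/-! ### The least favourable direction -/

section LeastFavourable

variable {S : Type*} [Fintype S] [DecidableEq S] [MeasurableSpace S] [MeasurableSingletonClass S]

/-- The sign with which the value of an arm enters the average treatment effect. -/
def armSign (a : Action) : ℝ := if a then 1 else -1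

omit [MeasurableSingletonClass S] in
lemma sigmaAB_eq_sum (γ : ℝ) (v : S → Action → ℝ≥0) (θ : Param S) (μ : S → ℝ) :
    sigmaAB γ v θ μ = ∑ a, 2 • armCov γ v θ μ (armPolicy a) := by
  rw [Fintype.sum_bool]
  rfl

omit [MeasurableSingletonClass S] in
lemma ate_eq_sum (γ : ℝ) (v : S → Action → ℝ≥0) (θ : Param S) :
    ate γ v θ = ∑ a, armSign a • value γ v θ (armPolicy a) := by
  funext s
  simp [ate, armSign, treatmentPolicy_eq_armPolicy, controlPolicy_eq_armPolicy, sub_eq_add_neg]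

/-- The efficiency bound for a single linear combination of the effects.  With
`y_a = (I - γ P^a)⁻ᵀ x` and `c s a = ± y_a(s) / μ(s)`, the direction whose score is
`c s a * (r + γ V^a(s') - E[r + γ V^a(s')])` has derivative `D = xᵀ Σ_AB x / 2` and Fisher
information `T D / 2`, so that the Cramér–Rao inequality gives `D ^ 2 ≤ Var * T D / 2`. -/
lemma dotProduct_sigmaAB_mulVec_le {γ : ℝ} (hγ0 : 0 ≤ γ) (hγ1 : γ < 1) {v : S → Action → ℝ≥0}
    {θ : Param S} (hθ : θ ∈ paramSpace S) {μ : S → ℝ}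
    (hμ : IsStationary μ (transitionMatrix θ mixedPolicy)) (hμpos : ∀ s, 0 < μ s) {T : ℕ}
    {est : Trajectory S T → S → ℝ} (hL2 : ∀ s, MemLp (fun τ => est τ s) 2 (experimentLaw v μ T θ))
    (hloc : IsLocallyUnbiasedAt γ v μ est θ) (x : S → ℝ) :
    x ⬝ᵥ (sigmaAB γ v θ μ *ᵥ x) ≤
      T * Var[fun τ => ∑ s, x s * est τ s; experimentLaw v μ T θ] := by
  set V : Action → S → ℝ := fun a => value γ v θ (armPolicy a) with hV
  set y : Action → S → ℝ := fun a => ((1 - γ • transitionMatrix θ (armPolicy a))⁻¹)ᵀ *ᵥ x with hy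
  set c : S → Action → ℝ := fun s a => armSign a * y a s / μ s with hc
  set φ : S → Action → S → ℝ := fun s a s' =>
    c s a * (γ * (V a s' - ∑ s'', θ.1 s a s'' * V a s'')) with hφ
  set D : Action → ℝ := fun a => ∑ s, y a s ^ 2 * (bellmanVariance γ v θ (V a) s a / μ s) with hD
  have hsign : ∀ a, armSign a ^ 2 = 1 := fun a => by cases a <;> simp [armSign]
  have hφ0 : ∀ s a, ∑ s', θ.1 s a s' * φ s a s' = 0 := fun s a => by
    set m := ∑ s'', θ.1 s a s'' * V a s'' with hm
    have : ∀ s', θ.1 s a s' * φ s a s' =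
        c s a * γ * (θ.1 s a s' * V a s' - θ.1 s a s' * m) := fun s' => by
      simp only [hφ, ← hm]
      ring
    simp_rw [this]
    rw [← Finset.mul_sum, Finset.sum_sub_distrib, ← Finset.sum_mul, hθ.2, ← hm]
    ring
  have hquad : x ⬝ᵥ (sigmaAB γ v θ μ *ᵥ x) = 2 * ∑ a, D a := by
    rw [sigmaAB_eq_sum, Matrix.sum_mulVec, dotProduct_sum, Finset.mul_sum]
    refine Finset.sum_congr rfl fun a _ => ?_
    rw [two_smul, Matrix.add_mulVec, dotProduct_add, dotProduct_armCov_mulVec, ← two_mul]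
  have hderiv : ∀ a, armSign a * ∑ s, y a s * (c s a * v s a +
      γ * ∑ s', θ.1 s a s' * φ s a s' * V a s') = D a := fun a => by
    simp only [hD, Finset.mul_sum _ _ (armSign a)]
    refine Finset.sum_congr rfl fun s _ => ?_
    have h1 : ∑ s', θ.1 s a s' * φ s a s' * V a s' = c s a * γ *
        ∑ s', θ.1 s a s' * (V a s' - ∑ s'', θ.1 s a s'' * V a s'') * V a s' := by
      rw [Finset.mul_sum]
      exact Finset.sum_congr rfl fun s' _ => by simp only [hφ]; ring
    rw [h1, sum_mul_sub_mean_mul, bellmanVariance]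
    simp only [hc]
    linear_combination (y a s ^ 2 * (v s a + γ ^ 2 * (∑ s', θ.1 s a s' * V a s' ^ 2 -
      (∑ s', θ.1 s a s' * V a s') ^ 2)) / μ s) * hsign a
  have hinfo : ∑ s, μ s * ∑ a, mixedPolicy s a *
      (∑ s', θ.1 s a s' * φ s a s' ^ 2 + c s a ^ 2 * v s a) = 1 / 2 * ∑ a, D a := by
    simp only [hD, Finset.mul_sum _ _ (1 / 2 : ℝ)]
    rw [Finset.sum_comm]
    refine Finset.sum_congr rfl fun s _ => ?_
    rw [Finset.mul_sum]
    refine Finset.sum_congr rfl fun a _ => ?_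
    have h1 : ∑ s', θ.1 s a s' * φ s a s' ^ 2 = c s a ^ 2 * γ ^ 2 *
        ∑ s', θ.1 s a s' * (V a s' - ∑ s'', θ.1 s a s'' * V a s'') ^ 2 := by
      rw [Finset.mul_sum]
      exact Finset.sum_congr rfl fun s' _ => by simp only [hφ]; ring
    rw [h1, sum_mul_sub_mean_sq hθ, bellmanVariance, mixedPolicy_apply]
    have hc2 : μ s * c s a ^ 2 = y a s ^ 2 / μ s := by
      have := (hμpos s).ne'
      simp only [hc, div_pow, mul_pow, hsign]
      field_simp
    linear_combination (1 / 2 * (v s a + γ ^ 2 * (∑ s', θ.1 s a s' * V a s' ^ 2 -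
      (∑ s', θ.1 s a s' * V a s') ^ 2))) * hc2
  have hd : Filter.Tendsto (fun t => t⁻¹ * (x ⬝ᵥ (ate γ v (tiltedParam v θ φ c t) - ate γ v θ)))
      (𝓝[≠] 0) (𝓝 (∑ a, D a)) := by
    have h := tendsto_finsetSum Finset.univ fun a (_ : a ∈ Finset.univ) =>
      (tendsto_slope_dotProduct_value (v := v) hγ0 hγ1 hθ hφ0 c a x).const_mul (armSign a)
    rw [← Finset.sum_congr rfl fun a _ => hderiv a]
    refine h.congr fun t => ?_
    rw [ate_eq_sum, ate_eq_sum, ← Finset.sum_sub_distrib, dotProduct_sum, Finset.mul_sum]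
    refine Finset.sum_congr rfl fun a _ => ?_
    rw [← smul_sub, dotProduct_smul, smul_eq_mul]
    ring
  have key := sq_derivative_le_variance_mul_information hθ hφ0 c hμ hL2 hloc x hd
  rw [hinfo] at key
  rw [hquad]
  have hvar := variance_nonneg (fun τ => ∑ s, x s * est τ s) (experimentLaw v μ T θ)
  rcases le_or_gt (∑ a, D a) 0 with h | h
  · have : 0 ≤ (T : ℝ) * Var[fun τ => ∑ s, x s * est τ s; experimentLaw v μ T θ] := by positivity
    linarith
  · nlinarith

omit [DecidableEq S] [MeasurableSingletonClass S] in
lemma dotProduct_estimatorCov_mulVec {v : S → Action → ℝ≥0} {θ : Param S} {μ : S → ℝ} {T : ℕ}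
    [IsProbabilityMeasure (experimentLaw v μ T θ)] {est : Trajectory S T → S → ℝ}
    (hL2 : ∀ s, MemLp (fun τ => est τ s) 2 (experimentLaw v μ T θ)) (x : S → ℝ) :
    x ⬝ᵥ (estimatorCov v μ est θ *ᵥ x) =
      Var[fun τ => ∑ s, x s * est τ s; experimentLaw v μ T θ] := by
  rw [← covariance_self (memLp_finsetSum _ fun s _ => (hL2 s).const_mul (x s)).aemeasurable,
    covariance_fun_sum_fun_sum (fun s => (hL2 s).const_mul (x s))
      fun s => (hL2 s).const_mul (x s)]
  simp only [covariance_const_mul_left, covariance_const_mul_right, dotProduct, Matrix.mulVec,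
    estimatorCov, Matrix.of_apply, Finset.mul_sum]
  exact Finset.sum_congr rfl fun s _ => Finset.sum_congr rfl fun s' _ => by ring

omit [DecidableEq S] [MeasurableSingletonClass S] in
lemma isHermitian_estimatorCov (v : S → Action → ℝ≥0) (μ : S → ℝ) {T : ℕ}
    (est : Trajectory S T → S → ℝ) (θ : Param S) : (estimatorCov v μ est θ).IsHermitian := by
  ext s s'
  simp [estimatorCov, covariance_comm]

end LeastFavourable

/-! ### Unbiased and locally unbiased estimators -/

section Bound

variable {S : Type*} [Fintype S] [DecidableEq S] [MeasurableSpace S]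

lemma IsUnbiased.isLocallyUnbiasedAt {γ : ℝ} {v : S → Action → ℝ≥0} {μ : S → ℝ} {T : ℕ}
    {est : Trajectory S T → S → ℝ} (h : IsUnbiased γ v μ est) {θ : Param S}
    (hθ : θ ∈ paramSpace S) : IsLocallyUnbiasedAt γ v μ est θ := by
  refine fun s => ⟨(h θ hθ s).2, (isLittleO_zero _ _).congr' ?_ Filter.EventuallyEq.rfl⟩
  filter_upwards [self_mem_nhdsWithin] with θ' hθ'
  rw [(h θ' hθ' s).2, sub_self]

end Bound

end ABTesting

theorem mainTheorem6 {S : Type*} [Fintype S] [DecidableEq S] [MeasurableSpace S]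
    [MeasurableSingletonClass S]
    (γ : ℝ) (hγ0 : 0 ≤ γ) (hγ1 : γ < 1)
    (v : S → ABTesting.Action → ℝ≥0)
    (θ : ABTesting.Param S) (hθ : θ ∈ ABTesting.paramSpace S)
    (μ : S → ℝ)
    (hμ : ABTesting.IsStationary μ (ABTesting.transitionMatrix θ ABTesting.mixedPolicy))
    (hμpos : ∀ s, 0 < μ s)
    (T : ℕ) (hT : 1 ≤ T)
    (est : ABTesting.Trajectory S T → S → ℝ) (hest : Measurable est)
    (hL2 : ∀ s, MemLp (fun τ => est τ s) 2 (ABTesting.experimentLaw v μ T θ)) :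
    (ABTesting.IsUnbiased γ v μ est →
      ((T : ℝ) • ABTesting.estimatorCov v μ est θ - ABTesting.sigmaAB γ v θ μ).PosSemidef) ∧
    (ABTesting.IsLocallyUnbiasedAt γ v μ est θ →
      ((T : ℝ) • ABTesting.estimatorCov v μ est θ - ABTesting.sigmaAB γ v θ μ).PosSemidef) := by
  suffices h : ABTesting.IsLocallyUnbiasedAt γ v μ est θ →
      ((T : ℝ) • ABTesting.estimatorCov v μ est θ - ABTesting.sigmaAB γ v θ μ).PosSemidef from
    ⟨fun hu => h (hu.isLocallyUnbiasedAt hθ), h⟩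
  intro hloc
  have hprob : IsProbabilityMeasure (ABTesting.experimentLaw v μ T θ) :=
    ABTesting.isProbabilityMeasure_trajectoryLaw v hθ ABTesting.mixedPolicy_isPolicy
      hμ.nonneg hμ.sum_eq_one T
  refine .of_dotProduct_mulVec_nonneg ?_ fun x => ?_
  · have h1 : ((T : ℝ) • ABTesting.estimatorCov v μ est θ).IsHermitian := by
      have h := ABTesting.isHermitian_estimatorCov v μ est θ
      rw [Matrix.IsHermitian, Matrix.conjTranspose_smul, h.eq, star_trivial]
    have h2 : (ABTesting.sigmaAB γ v θ μ).IsHermitian := by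
      rw [ABTesting.sigmaAB, two_smul, two_smul]
      have h := ABTesting.isHermitian_armCov γ v θ μ
      exact ((h _).add (h _)).add ((h _).add (h _))
    exact h1.sub h2
  · have h := ABTesting.dotProduct_sigmaAB_mulVec_le hγ0 hγ1 hθ hμ hμpos hL2 hloc x
    rw [star_trivial, Matrix.sub_mulVec, dotProduct_sub, Matrix.smul_mulVec, dotProduct_smul,
      ABTesting.dotProduct_estimatorCov_mulVec hL2, smul_eq_mul]
    exact sub_nonneg.2 h
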